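/- An \emph{ordered tree} is a finite tree $T$ together with a prescribed clockwise cyclic order of the incident edges around each vertex; $|T|$ is its underlying topological space. A \emph{drawing} of $T$ is a continuous injection $\phi\colon |T|\to\mathbb{R}^2$ such that the image of every edge is piecewise linear, every vertical line meets $\phi(|T|)$ in finitely many points, and the clockwise order in which the edges leave each vertex is the prescribed one. Its height $H(\phi)$ is the maximum number of points of $\phi(|T|)$ on a vertical line. The locations of the \emph{moves} of $\phi$ are the vertices and the points of edges at which the $x$-coordinate of $\phi$ has a local extremum (bends). Let $e=vr$ be an edge of $T$ and let $T'$ be the sub-tree with root $r$ anchored at $v$ via $e$, i.e. the component containing $r$ of $T$ with $e$ removed. We say that $\phi'$ is obtained from $\phi$ by \emph{bubbling $T'$ at the point $t\in\mathbb{R}^2$, in the bubble} $Q=[a,b]\times[c,d]$ ($a<b$, $c<d$), if $\phi'$ is a drawing of $T$ such that (i) $H(\phi')\le H(\phi)$; (ii) $T'$ is drawn by $\phi'$ in the interior of $Q$; only points of $T'$ and interior points of $e$ are drawn in $Q$; $\phi'(|T|)\cap\partial Q=\{t\}$, where $t$ lies on the image of the interior of $e$ and in the relative interior of the left or the right side of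 $Q$; and no move of $\phi'$ located outside $Q$ lies in the vertical strip $[a,b]\times\mathbb{R}$; (iii) $\phi'=\phi$ at all points of $|T|$ outside $T'$ and outside the interior of $e$; (iv) the part of $\phi'(e)$ outside the bubble $Q$ is contained in $\phi(T'\cup e)$. \textbf{Lemma.} Let $\phi$ be a drawing of an ordered tree $T$ for which the points $t_l$ and $t_r$ of $|T|$ with the smallest and the largest $x$-coordinate are unique. Let $T'$ be the sub-tree with root $r$ anchored at a vertex $v$ via an edge $e=vr$, and suppose that $T'$ contains exactly one of $t_l$ and $t_r$. Then $T'$ can be bubbled at that point, in an arbitrarily small bubble: for every $\varepsilon>0$, \begin{itemize} \item if $t_r\in T'$, there are a drawing $\phi'$ and a rectangle $Q$ of width and height less than $\varepsilon$ such that $\phi'$ is obtained from $\phi$ by bubbling $T'$ at $\phi(t_r)$ in $Q$, with $\phi(t_r)$ on the left side of $Q$; \item if $t_l\in T'$, there are a drawing $\phi'$ and a rectangle $Q$ of width and height less than $\varepsilon$ such that $\phi'$ is obtained from $\phi$ by bubbling $T'$ at $\phi(t_l)$ in $Q$, with $\phi(t_l)$ on the right side of $Q$. \end{itemize} Moreover,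 if all moves of $\phi$ have distinct $x$-coordinates, then $\phi'$ can be chosen to have this property as well. -/

import Mathlib

open Set Filter Topology

/-- A finite ordered tree: a tree in which, at every vertex, a cyclic order of the
incident edges (that is, of the neighbours) is prescribed.  `sbtw a b c` is read as:
going clockwise around the vertex, one meets `a`, `b`, `c` in this cyclic order. -/
structure OrderedTree (V : Type*) where
  graph : SimpleGraph V
  isTree : graph.IsTree
  clockwise : ∀ v : V, CircularOrder (graph.neighborSet v)

namespace OrderedTree

variable {V : Type*} [Fintype V] [DecidableEq V]

/-- The point of the geometric realization that corresponds to a vertex: the realization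
of the tree lives in `ℝ^V`, with the vertices at the standard basis vectors. -/
def vtx (u : V) : V → ℝ := Pi.single u 1

/-- The closed edge joining `u` and `w`, in the geometric realization. -/
def edge (u w : V) : Set (V → ℝ) := segment ℝ (vtx u) (vtx w)

/-- The edge joining `u` and `w` without its two endpoints. -/
def openEdge (u w : V) : Set (V → ℝ) := openSegment ℝ (vtx u) (vtx w)

/-- The geometric realization of the subgraph induced on the vertex set `S`. -/
def pointsOn (T : OrderedTree V) (S : Set V) : Set (V → ℝ) :=
  {p | (∃ u ∈ S, p = vtx u) ∨ ∃ u ∈ S, ∃ w ∈ S, T.graph.Adj u w ∧ p ∈ edge u w}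

/-- The underlying topological space `|T|` of the tree. -/
def points (T : OrderedTree V) : Set (V → ℝ) := T.pointsOn univ

/-- For an edge `v r`, the points of the rooted sub-tree with root `r` that is anchored at
`v` via this edge: the component containing `r` after removal of the edge. -/
def anchored (T : OrderedTree V) (v r : V) : Set (V → ℝ) :=
  T.pointsOn {u | (T.graph.deleteEdges {s(v, r)}).Reachable r u}

/-- A subset of the plane is piecewise linear if it is a finite union of segments. -/
def IsPolygonal (A : Set ℂ) : Prop :=
  ∃ F : Finset (ℂ × ℂ), A = ⋃ p ∈ F, segment ℝ p.1 p.2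

/-- The angle under which the point at parameter `s` of the edge `u w` is seen from `u`
in `φ`. -/
noncomputable def angle (φ : (V → ℝ) → ℂ) (u w : V) (s : ℝ) : Real.Angle :=
  (Complex.arg (φ (AffineMap.lineMap (vtx u) (vtx w) s) - φ (vtx u)) : Real.Angle)

/-- In `φ`, the edges from `u` to `a`, `b`, `c` leave `u` in this clockwise cyclic order.
(The cyclic order of Mathlib on angles is the counterclockwise one.) -/
def LeaveClockwise (φ : (V → ℝ) → ℂ) (u a b c : V) : Prop :=
  ∀ᶠ s in 𝓝[>] (0 : ℝ), sbtw (angle φ u c s) (angle φ u b s) (angle φ u a s)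

/-- `φ` is a drawing of the ordered tree `T` in the plane `ℝ² = ℂ` (the values of `φ` off
`|T|` are irrelevant): a continuous injection of `|T|` under which every edge has a
piecewise-linear image, every vertical line meets the drawing in finitely many points, and
the clockwise order of the edges around each vertex is the prescribed one. -/
structure IsDrawing (T : OrderedTree V) (φ : (V → ℝ) → ℂ) : Prop where
  continuousOn : ContinuousOn φ T.points
  injOn : InjOn φ T.points
  polygonal : ∀ u w, T.graph.Adj u w → IsPolygonal (φ '' edge u w)
  finite_vertical : ∀ x : ℝ, {z ∈ φ '' T.points | z.re = x}.Finite
  clockwise : ∀ (u : V) (a b c : T.graph.neighborSet u),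
    (T.clockwise u).toSBtw.sbtw a b c ↔ LeaveClockwise φ u a b c

/-- The height of a drawing: the maximum number of its points on a vertical line. -/
noncomputable def height (T : OrderedTree V) (φ : (V → ℝ) → ℂ) : ℕ∞ :=
  ⨆ x : ℝ, {z ∈ φ '' T.points | z.re = x}.encard

/-- The locations of the moves of a drawing: the vertices, and the points of the edges at
which the `x`-coordinate has a local extremum (left and right bends). -/
def IsMove (T : OrderedTree V) (φ : (V → ℝ) → ℂ) (p : V → ℝ) : Prop :=
  p ∈ T.points ∧ ((∃ u, p = vtx u) ∨ IsLocalExtrOn (fun q => (φ q).re) T.points p)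

/-- No two moves of the drawing have the same `x`-coordinate. -/
def DistinctMoves (T : OrderedTree V) (φ : (V → ℝ) → ℂ) : Prop :=
  InjOn (fun p => (φ p).re) {p | T.IsMove φ p}

/-- In the drawing `φ`, the sub-tree with root `r` anchored at `v` is drawn in the bubble
`[a, b] × [c, d]`, the edge `v r` being the single boundary edge and `t` being its point on
the boundary, on the left or on the right side.  So the sub-tree lies in the interior of
the rectangle, nothing but it and a part of its anchor edge lies in the rectangle, the
drawing meets the boundary of the rectangle only in `t`, and the closed vertical strip over
`[a, b]` contains no move of the rest of the drawing. -/
structure IsBubble (T : OrderedTree V) (φ : (V → ℝ) → ℂ) (v r : V) (t : ℂ)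
    (a b c d : ℝ) : Prop where
  lt_x : a < b
  lt_y : c < d
  side : t.re = a ∨ t.re = b
  im_mem : t.im ∈ Ioo c d
  mem_edge : t ∈ φ '' openEdge v r
  interior : ∀ p ∈ T.anchored v r, φ p ∈ Ioo a b ×ℂ Ioo c d
  only : ∀ p ∈ T.points, φ p ∈ Icc a b ×ℂ Icc c d → p ∈ T.anchored v r ∪ openEdge v r
  boundary : φ '' T.points ∩ frontier (Icc a b ×ℂ Icc c d) = {t}
  strip : ∀ p, T.IsMove φ p → φ p ∉ Icc a b ×ℂ Icc c d → (φ p).re ∉ Icc a b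

/-- `φ'` is obtained from the drawing `φ` by bubbling the sub-tree with root `r` anchored
at `v`, at the point `t`, the bubble being `[a, b] × [c, d]`.  The last condition concerns
the anchor edge up to the bubble; the remaining part of it belongs to the drawing inside
the bubble. -/
structure IsBubbling (T : OrderedTree V) (φ φ' : (V → ℝ) → ℂ) (v r : V) (t : ℂ)
    (a b c d : ℝ) : Prop where
  isDrawing : T.IsDrawing φ'
  height_le : T.height φ' ≤ T.height φ
  isBubble : T.IsBubble φ' v r t a b c d
  unchanged : ∀ p ∈ T.points, p ∉ T.anchored v r → p ∉ openEdge v r → φ' p = φ p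
  edge_subset : φ' '' edge v r \ (Icc a b ×ℂ Icc c d) ⊆ φ '' (T.anchored v r ∪ edge v r)

end OrderedTree

/-! Let `px` be the extreme point that lies in the sub-tree T', and `py` the opposite extreme point,
which lies outside T'. A nonzero real `κ` encodes the direction of `px` by its sign, so that both
halves of the lemma become one statement. Shrink the whole old drawing and translate it so that the
image of `py` lands on that of `px`. The original lies strictly on one side of the vertical line
through φ(`px`), the copy strictly on the other, except for this single contact point
(`IsSurgery.eq_of_eq_shrink`).

Now draw T' as in the copy and leave the component of v as in the original. Redraw the edge e from v
along its old image to r, on through T' to `px`, across the contact point, and then along the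
shrunken path from `py` to r. The room is vacant: the original no longer carries T' or e, and the
copy carries T' but nothing else. The path from `py` to r meets T' only in r, also when `py` lies on
e itself.

Each vertical line meets the new drawing in a subset of the original or of the copy
(`IsSurgery.vertical_cases`), which gives finiteness and the height bound. Near each vertex the
drawing agrees with the original or with the copy, so the cyclic orders survive
(`IsSurgery.angle_redraw`). A move of the new drawing comes from a move of φ on one of the two
sides, since the traversed paths end, away from the contact point, only at vertices, and the contact
point is crossed without a turn (`IsSurgery.isMove_redraw`). A small ratio puts the copy into a
small rectangle (`exists_isBubbling`). The paths and the parametrization of the new edge are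
supplied by `exists_arc_anchored` and `exists_isSurgery`. -/

/-! ### Arcs: gluing, reversal and reparametrization. -/

section Arcs

/-- Two functions glued at the parameter `b`. -/
noncomputable def glue {E : Type*} (b : ℝ) (f g : ℝ → E) (t : ℝ) : E :=
  if t ≤ b then f t else g t

theorem glue_eqOn_left {E : Type*} (b : ℝ) (f g : ℝ → E) : EqOn (glue b f g) f (Iic b) :=
  fun _ ht => if_pos ht

theorem glue_eqOn_right {E : Type*} {b : ℝ} {f g : ℝ → E} (h : f b = g b) :
    EqOn (glue b f g) g (Ici b) := by
  intro t ht
  rcases eq_or_lt_of_le (mem_Ici.1 ht) with rfl | hlt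
  · simp [glue, h]
  · simp [glue, not_le.2 hlt]

variable {E F : Type*} [TopologicalSpace E] [TopologicalSpace F]

theorem continuousOn_glue {a b c : ℝ} (hab : a ≤ b) (hbc : b ≤ c) {f g : ℝ → E}
    (hf : ContinuousOn f (Icc a b)) (hg : ContinuousOn g (Icc b c)) (h : f b = g b) :
    ContinuousOn (glue b f g) (Icc a c) := by
  rw [← Icc_union_Icc_eq_Icc hab hbc]
  refine ContinuousOn.union_of_isClosed ?_ ?_ isClosed_Icc isClosed_Icc
  · exact hf.congr ((glue_eqOn_left b f g).mono Icc_subset_Iic_self)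
  · exact hg.congr ((glue_eqOn_right h).mono Icc_subset_Ici_self)

theorem image_glue {E : Type*} {a b c : ℝ} (hab : a ≤ b) (hbc : b ≤ c) {f g : ℝ → E} (h : f b = g b) :
    glue b f g '' Icc a c = f '' Icc a b ∪ g '' Icc b c := by
  rw [← Icc_union_Icc_eq_Icc hab hbc, image_union,
    ((glue_eqOn_left b f g).mono Icc_subset_Iic_self).image_eq,
    ((glue_eqOn_right h).mono Icc_subset_Ici_self).image_eq]

theorem injOn_glue {E : Type*} {a b c : ℝ} (hab : a ≤ b) (hbc : b ≤ c) {f g : ℝ → E}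
    (hf : InjOn f (Icc a b)) (hg : InjOn g (Icc b c)) (h : f b = g b)
    (hfg : f '' Icc a b ∩ g '' Icc b c ⊆ {f b}) :
    InjOn (glue b f g) (Icc a c) := by
  have key : ∀ s ∈ Icc a b, ∀ t ∈ Icc b c, f s = g t → s = t := by
    intro s hs t ht hst
    have h1 : f s = f b := hfg ⟨mem_image_of_mem _ hs, hst ▸ mem_image_of_mem _ ht⟩
    rw [hf hs (right_mem_Icc.2 hab) h1]
    exact hg (left_mem_Icc.2 hbc) ht (by rw [← h, ← h1, hst])
  intro s hs t ht hst
  rcases le_total s b with h1 | h1 <;> rcases le_total t b with h2 | h2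
  · rw [glue_eqOn_left b f g h1, glue_eqOn_left b f g h2] at hst
    exact hf ⟨hs.1, h1⟩ ⟨ht.1, h2⟩ hst
  · rw [glue_eqOn_left b f g h1, glue_eqOn_right h h2] at hst
    exact key s ⟨hs.1, h1⟩ t ⟨h2, ht.2⟩ hst
  · rw [glue_eqOn_right h h1, glue_eqOn_left b f g h2] at hst
    exact (key t ⟨ht.1, h2⟩ s ⟨h1, hs.2⟩ hst.symm).symm
  · rw [glue_eqOn_right h h1, glue_eqOn_right h h2] at hst
    exact hg ⟨h1, hs.2⟩ ⟨h2, ht.2⟩ hst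

/-- `A` is an arc from `x` to `y`, possibly degenerated to a point. -/
def IsArc (A : Set E) (x y : E) : Prop :=
  ∃ (a b : ℝ) (g : ℝ → E), a ≤ b ∧ ContinuousOn g (Icc a b) ∧ InjOn g (Icc a b) ∧
    g '' Icc a b = A ∧ g a = x ∧ g b = y

theorem IsArc.refl (x : E) : IsArc {x} x x :=
  ⟨0, 0, fun _ => x, le_rfl, continuousOn_const, by simp, by simp, rfl, rfl⟩

theorem isArc_image_Icc {a b : ℝ} (hab : a ≤ b) {g : ℝ → E} (hg : ContinuousOn g (Icc a b))
    (hi : InjOn g (Icc a b)) : IsArc (g '' Icc a b) (g a) (g b) :=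
  ⟨a, b, g, hab, hg, hi, rfl, rfl, rfl⟩

theorem IsArc.left_mem {A : Set E} {x y : E} (h : IsArc A x y) : x ∈ A := by
  obtain ⟨a, b, g, hab, -, -, rfl, rfl, rfl⟩ := h
  exact mem_image_of_mem _ (left_mem_Icc.2 hab)

theorem IsArc.right_mem {A : Set E} {x y : E} (h : IsArc A x y) : y ∈ A := by
  obtain ⟨a, b, g, hab, -, -, rfl, rfl, rfl⟩ := h
  exact mem_image_of_mem _ (right_mem_Icc.2 hab)

theorem IsArc.isPreconnected {A : Set E} {x y : E} (h : IsArc A x y) : IsPreconnected A := by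
  obtain ⟨a, b, g, hab, hg, -, rfl, rfl, rfl⟩ := h
  exact isPreconnected_Icc.image _ hg

theorem IsArc.symm {A : Set E} {x y : E} (h : IsArc A x y) : IsArc A y x := by
  obtain ⟨a, b, g, hab, hg, hi, rfl, rfl, rfl⟩ := h
  have hn : Neg.neg '' Icc (-b) (-a) = Icc a b := by simp
  have hm : MapsTo Neg.neg (Icc (-b) (-a)) (Icc a b) := hn ▸ mapsTo_image _ _
  refine ⟨-b, -a, g ∘ Neg.neg, by linarith, hg.comp continuousOn_neg hm,
    hi.comp neg_injective.injOn hm, by rw [image_comp, hn], by simp, by simp⟩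

theorem IsArc.image {A : Set E} {x y : E} (h : IsArc A x y) {f : E → F}
    (hf : ContinuousOn f A) (hi : InjOn f A) : IsArc (f '' A) (f x) (f y) := by
  obtain ⟨a, b, g, hab, hg, hgi, rfl, rfl, rfl⟩ := h
  exact ⟨a, b, f ∘ g, hab, hf.comp hg (mapsTo_image _ _), hi.comp hgi (mapsTo_image _ _),
    image_comp _ _ _, rfl, rfl⟩

/-- A nondegenerate arc can be parametrized over any interval. -/
theorem IsArc.exists_parametrization {A : Set E} {x y : E} (h : IsArc A x y) (hxy : x ≠ y)
    {c d : ℝ} (hcd : c < d) : ∃ g : ℝ → E, ContinuousOn g (Icc c d) ∧ InjOn g (Icc c d) ∧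
      g '' Icc c d = A ∧ g c = x ∧ g d = y := by
  obtain ⟨a, b, g, hab, hg, hi, rfl, rfl, rfl⟩ := h
  have hab : a < b := lt_of_le_of_ne hab (fun h => hxy (h ▸ rfl))
  have hk : 0 < (b - a) / (d - c) := div_pos (by linarith) (by linarith)
  set k := (b - a) / (d - c) with hkdef
  have hkd : k * (d - c) = b - a := by rw [hkdef]; field_simp [(sub_pos.2 hcd).ne']
  have hn : (fun t => k * t + (a - k * c)) '' Icc c d = Icc a b := by
    rw [image_affine_Icc' hk]; congr 1 <;> linarith
  have hm : MapsTo (fun t => k * t + (a - k * c)) (Icc c d) (Icc a b) := hn ▸ mapsTo_image _ _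
  refine ⟨g ∘ fun t => k * t + (a - k * c), hg.comp (by fun_prop) hm, hi.comp ?_ hm,
    by rw [image_comp, hn], ?_, ?_⟩
  · intro s _ t _ hst
    exact mul_left_cancel₀ hk.ne' (add_right_cancel hst)
  · simp
  · simp only [Function.comp]; congr 1; linarith

theorem IsArc.trans {A B : Set E} {x y z : E} (hA : IsArc A x y) (hB : IsArc B y z)
    (h : A ∩ B ⊆ {y}) : IsArc (A ∪ B) x z := by
  obtain ⟨a, b, f, hab, hf, hfi, rfl, rfl, rfl⟩ := hA
  obtain ⟨c, d, g, hcd, hg, hgi, rfl, hgc, rfl⟩ := hB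
  have hn : (fun t => t + (c - b)) '' Icc b (b + (d - c)) = Icc c d := by
    rw [image_add_const_Icc]; congr 1 <;> ring
  have hm : MapsTo (fun t => t + (c - b)) (Icc b (b + (d - c))) (Icc c d) :=
    hn ▸ mapsTo_image _ _
  have hbc : b ≤ b + (d - c) := by linarith
  have him : (g ∘ fun t => t + (c - b)) '' Icc b (b + (d - c)) = g '' Icc c d := by
    rw [image_comp, hn]
  have hfg : f b = (g ∘ fun t => t + (c - b)) b := by simp [hgc]
  refine ⟨a, b + (d - c), glue b f (g ∘ fun t => t + (c - b)), by linarith,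
    continuousOn_glue hab hbc hf (hg.comp (by fun_prop) hm) hfg,
    injOn_glue hab hbc hfi (hgi.comp (add_left_injective _).injOn hm) hfg (by rwa [him]),
    by rw [image_glue hab hbc hfg, him], glue_eqOn_left _ _ _ hab, ?_⟩
  rw [glue_eqOn_right hfg hbc]
  simp only [Function.comp]; congr 1; ring

end Arcs

/-! ### Transfer of local extrema to the image of an embedding. -/

section Extrema

variable {E F : Type*} [TopologicalSpace E] [TopologicalSpace F] [T2Space F]

/-- The inverse of an injective continuous map on a compact set is continuous: what lies outside an
open neighbourhood of `p` has a compact, hence closed, image, and injectivity keeps `f p` out of it.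
-/
theorem nhdsWithin_image_le_map {K : Set E} (hK : IsCompact K) {f : E → F}
    (hf : ContinuousOn f K) (hi : InjOn f K) {p : E} (hp : p ∈ K) :
    𝓝[f '' K] (f p) ≤ map f (𝓝[K] p) := by
  intro s hs
  obtain ⟨U, hU, hpU, hUs⟩ := mem_nhdsWithin.1 (mem_map.1 hs)
  have hc : IsClosed (f '' (K \ U)) :=
    ((hK.diff hU).image_of_continuousOn (hf.mono sdiff_subset)).isClosed
  have hpn : f p ∉ f '' (K \ U) := by
    rintro ⟨q, hq, hqp⟩
    exact hq.2 (hi hq.1 hp hqp ▸ hpU)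
  refine mem_nhdsWithin.2 ⟨_, hc.isOpen_compl, hpn, ?_⟩
  rintro _ ⟨hz, q, hq, rfl⟩
  by_cases hqU : q ∈ U
  · exact hUs ⟨hqU, hq⟩
  · exact absurd ⟨q, (⟨hq, hqU⟩ : q ∈ K \ U), rfl⟩ hz

/-- Local extrema of a function composed with an embedding of a compact set are local extrema
on the image. -/
theorem IsLocalExtrOn.image_of_isCompact {K : Set E} (hK : IsCompact K) {f : E → F}
    (hf : ContinuousOn f K) (hi : InjOn f K) {p : E} (hp : p ∈ K) {h : F → ℝ}
    (hext : IsLocalExtrOn (fun q => h (f q)) K p) : IsLocalExtrOn h (f '' K) (f p) := by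
  have hle := nhdsWithin_image_le_map hK hf hi hp
  rcases hext with hext | hext
  · exact Or.inl (hle hext)
  · exact Or.inr (hle hext)

end Extrema

namespace OrderedTree

/-! ### Polygonal sets and how to cut them. -/

section Polygonal

theorem IsPolygonal.union {A B : Set ℂ} (hA : IsPolygonal A) (hB : IsPolygonal B) :
    IsPolygonal (A ∪ B) := by
  classical
  obtain ⟨F, rfl⟩ := hA
  obtain ⟨G, rfl⟩ := hB
  exact ⟨F ∪ G, by rw [Finset.set_biUnion_union]⟩

theorem isPolygonal_segment (x y : ℂ) : IsPolygonal (segment ℝ x y) := ⟨{(x, y)}, by simp⟩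

theorem isPolygonal_of_finite {A : Set ℂ} (hA : A.Finite) : IsPolygonal A := by
  classical
  exact ⟨hA.toFinset.image fun z => (z, z), by simp⟩

theorem isPolygonal_biUnion {ι : Type*} (F : Finset ι) {A : ι → Set ℂ}
    (h : ∀ i ∈ F, IsPolygonal (A i)) : IsPolygonal (⋃ i ∈ F, A i) := by
  classical
  induction F using Finset.induction_on with
  | empty => exact ⟨∅, by simp⟩
  | insert i F _ ih =>
    rw [Finset.set_biUnion_insert]
    exact (h i (by simp)).union (ih fun j hj => h j (by simp [hj]))

theorem IsPolygonal.image {A : Set ℂ} (hA : IsPolygonal A) (f : ℂ →ᵃ[ℝ] ℂ) :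
    IsPolygonal (f '' A) := by
  obtain ⟨F, rfl⟩ := hA
  rw [image_iUnion₂]
  exact isPolygonal_biUnion F fun p _ => by
    rw [image_segment]; exact isPolygonal_segment _ _

theorem openSegment_subset_left {x y z : ℂ} (hz : z ∈ openSegment ℝ x y) :
    openSegment ℝ x z ⊆ openSegment ℝ x y := by
  obtain ⟨c, d, hc, hd, hcd, rfl⟩ := hz
  rintro _ ⟨a, b, ha, hb, hab, rfl⟩
  refine ⟨a + b * c, b * d, by positivity, by positivity, ?_, by module⟩
  rw [add_assoc, ← mul_add, hcd, mul_one, hab]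

/-- Induction on the finite set of possible crossing points. Without crossings, connectedness puts
the open segment inside `B` or disjoint from it; otherwise the segment is split at a crossing point.
-/
theorem isPolygonal_inter_segment {B C : Set ℂ} (hB : IsClosed B) (hC : IsClosed C)
    (P : Finset ℂ) : ∀ x y : ℂ, segment ℝ x y ⊆ B ∪ C →
      (∀ z ∈ B ∩ C, z ∈ openSegment ℝ x y → z ∈ P) → IsPolygonal (B ∩ segment ℝ x y) := by
  classical
  induction P using Finset.induction_on with
  | empty =>
    intro x y hxy hP
    by_cases hne : (openSegment ℝ x y ∩ B).Nonempty
    · have hsub : openSegment ℝ x y ⊆ B := by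
        intro z hz
        by_contra hzB
        have hzC : z ∈ C :=
          (hxy (openSegment_subset_segment ℝ x y hz)).resolve_left hzB
        obtain ⟨w, hw, hwBC⟩ := isPreconnected_closed_iff.1
          (convex_openSegment (𝕜 := ℝ) x y).isPreconnected B C hB hC
          ((openSegment_subset_segment ℝ x y).trans hxy) hne ⟨z, hz, hzC⟩
        exact absurd (hP w hwBC hw) (by simp)
      have : segment ℝ x y ⊆ B := by
        rw [← closure_openSegment]; exact closure_minimal hsub hB
      rw [inter_eq_right.2 this]
      exact isPolygonal_segment x y
    · refine isPolygonal_of_finite ((Set.toFinite {x, y}).subset ?_)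
      rintro z ⟨hzB, hz⟩
      rw [← insert_endpoints_openSegment] at hz
      rcases hz with h | h | h
      · simp [h]
      · simp [h]
      · exact absurd ⟨z, h, hzB⟩ hne
  | insert z P hzP ih =>
    intro x y hxy hP
    rcases eq_or_ne x y with rfl | hne
    · rw [segment_same]
      exact isPolygonal_of_finite ((Set.finite_singleton x).inter_of_right B)
    by_cases hz : z ∈ openSegment ℝ x y
    · have hzs := openSegment_subset_segment ℝ x y hz
      have hzx : x ≠ z := fun h => hne (left_mem_openSegment_iff.1 (h.symm ▸ hz))
      have hzy : z ≠ y := fun h => hne (right_mem_openSegment_iff.1 (h ▸ hz))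
      have hr : z ∈ range (AffineMap.lineMap x y : ℝ → ℂ) := by
        rw [openSegment_eq_image_lineMap] at hz
        exact image_subset_range _ _ hz
      have h1 : segment ℝ x z ⊆ segment ℝ x y :=
        (convex_segment x y).segment_subset (left_mem_segment ℝ x y) hzs
      have h2 : segment ℝ z y ⊆ segment ℝ x y :=
        (convex_segment x y).segment_subset hzs (right_mem_segment ℝ x y)
      have h1' : openSegment ℝ x z ⊆ openSegment ℝ x y :=
        openSegment_subset_left hz
      have h2' : openSegment ℝ z y ⊆ openSegment ℝ x y := by
        rw [openSegment_symm ℝ z y, openSegment_symm ℝ x y] at *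
        exact openSegment_subset_left hz
      have hu : segment ℝ x y = segment ℝ x z ∪ segment ℝ z y := by
        refine Subset.antisymm ?_ (union_subset h1 h2)
        rw [← insert_endpoints_openSegment]
        rintro w (rfl | rfl | hw)
        · exact Or.inl (left_mem_segment ℝ _ _)
        · exact Or.inr (right_mem_segment ℝ _ _)
        · rcases openSegment_subset_union x y hr hw with rfl | hw | hw
          · exact Or.inl (right_mem_segment ℝ _ _)
          · exact Or.inl (openSegment_subset_segment ℝ _ _ hw)
          · exact Or.inr (openSegment_subset_segment ℝ _ _ hw)
      rw [hu, inter_union_distrib_left]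
      refine (ih x z (h1.trans hxy) ?_).union (ih z y (h2.trans hxy) ?_)
      · intro w hw hw'
        rcases Finset.mem_insert.1 (hP w hw (h1' hw')) with rfl | h
        · exact absurd (right_mem_openSegment_iff.1 hw') hzx
        · exact h
      · intro w hw hw'
        rcases Finset.mem_insert.1 (hP w hw (h2' hw')) with rfl | h
        · exact absurd (left_mem_openSegment_iff.1 hw') hzy
        · exact h
    · refine ih x y hxy fun w hw hw' => ?_
      rcases Finset.mem_insert.1 (hP w hw hw') with rfl | h
      · exact absurd hw' hz
      · exact h

/-- If a polygonal set is cut into two closed parts at finitely many points, then the parts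
are polygonal. -/
theorem IsPolygonal.of_union {B C : Set ℂ} (h : IsPolygonal (B ∪ C)) (hB : IsClosed B)
    (hC : IsClosed C) (hBC : (B ∩ C).Finite) : IsPolygonal B := by
  obtain ⟨F, hF⟩ := h
  have : B = ⋃ p ∈ F, B ∩ segment ℝ p.1 p.2 := by
    rw [← inter_iUnion₂, ← hF, inter_eq_left.2 subset_union_left]
  rw [this]
  refine isPolygonal_biUnion F fun p hp => isPolygonal_inter_segment hB hC hBC.toFinset _ _ ?_ ?_
  · rw [hF]; exact subset_biUnion_of_mem (u := fun p : ℂ × ℂ => segment ℝ p.1 p.2) hp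
  · intro z hz _; exact hBC.mem_toFinset.2 hz

end Polygonal

end OrderedTree

namespace OrderedTree

/-! ### The two components left by removing an edge. -/

section Vertices

variable {V : Type*} {T : OrderedTree V}

/-- The vertices of the sub-tree with root `r` anchored at `v`. -/
def anchoredVerts (T : OrderedTree V) (v r : V) : Set V :=
  {u | (T.graph.deleteEdges {s(v, r)}).Reachable r u}

theorem root_mem_anchoredVerts (v r : V) : r ∈ T.anchoredVerts v r :=
  SimpleGraph.Reachable.refl r

theorem anchor_notMem_anchoredVerts {v r : V} (h : T.graph.Adj v r) :
    v ∉ T.anchoredVerts v r := by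
  have hb := SimpleGraph.isAcyclic_iff_forall_isBridge.1 T.isTree.isAcyclic
    (e := s(v, r)) h
  intro hr
  exact (SimpleGraph.isBridge_iff.1 hb) hr.symm

/-- Induction on a walk from `u` to `r`: a first step along the removed edge starts at `v` or `r`
itself, and any other first step stays within one component. -/
theorem anchoredVerts_union (v r : V) (u : V) :
    u ∈ T.anchoredVerts v r ∨ u ∈ T.anchoredVerts r v := by
  obtain ⟨P⟩ := T.isTree.connected.preconnected u r
  induction P with
  | nil => exact Or.inl (root_mem_anchoredVerts _ _)
  | @cons a b c h P ih =>
    by_cases hab : s(a, b) = s(v, c)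
    · rcases Sym2.eq_iff.1 hab with ⟨rfl, rfl⟩ | ⟨rfl, rfl⟩
      · exact Or.inr (root_mem_anchoredVerts _ _)
      · exact Or.inl (root_mem_anchoredVerts _ _)
    · have hadj : (T.graph.deleteEdges {s(v, c)}).Adj b a := by
        rw [SimpleGraph.deleteEdges_adj]
        exact ⟨h.symm, fun h' => hab (Sym2.eq_swap.trans h')⟩
      refine ih.imp (fun h => h.trans hadj.reachable) fun h => ?_
      unfold anchoredVerts at h ⊢
      rw [Sym2.eq_swap] at h ⊢
      exact SimpleGraph.Reachable.trans h hadj.reachable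

theorem disjoint_anchoredVerts {v r : V} (h : T.graph.Adj v r) :
    Disjoint (T.anchoredVerts v r) (T.anchoredVerts r v) := by
  rw [Set.disjoint_left]
  intro u hu hu'
  apply anchor_notMem_anchoredVerts h
  unfold anchoredVerts at hu' hu ⊢
  rw [Sym2.eq_swap] at hu'
  exact SimpleGraph.Reachable.trans hu (SimpleGraph.Reachable.symm hu')

theorem adj_cases {v r x y : V} (h : T.graph.Adj x y) :
    (x ∈ T.anchoredVerts v r ∧ y ∈ T.anchoredVerts v r) ∨
    (x ∈ T.anchoredVerts r v ∧ y ∈ T.anchoredVerts r v) ∨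
    (x = v ∧ y = r) ∨ (x = r ∧ y = v) := by
  by_cases hxy : s(x, y) = s(v, r)
  · exact Or.inr (Or.inr (Sym2.eq_iff.1 hxy))
  · have hadj : (T.graph.deleteEdges {s(v, r)}).Adj x y := by
      rw [SimpleGraph.deleteEdges_adj]; exact ⟨h, hxy⟩
    rcases anchoredVerts_union (T := T) v r x with hx | hx
    · exact Or.inl ⟨hx, SimpleGraph.Reachable.trans hx hadj.reachable⟩
    · refine Or.inr (Or.inl ⟨hx, ?_⟩)
      unfold anchoredVerts at hx ⊢
      rw [Sym2.eq_swap] at hadj hx ⊢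
      rw [Sym2.eq_swap] at hadj
      exact SimpleGraph.Reachable.trans hx hadj.reachable

end Vertices

variable {V : Type*} [DecidableEq V]

/-! ### Barycentric coordinates on an edge. -/

section Coordinates

/-- The point at parameter `s` of the edge from `u` to `w`. -/
noncomputable def edgePt (u w : V) (s : ℝ) : V → ℝ := AffineMap.lineMap (vtx u) (vtx w) s

theorem edgePt_zero (u w : V) : edgePt u w 0 = vtx u := AffineMap.lineMap_apply_zero _ _

theorem edgePt_one (u w : V) : edgePt u w 1 = vtx w := AffineMap.lineMap_apply_one _ _

theorem edgePt_symm (u w : V) (s : ℝ) : edgePt u w s = edgePt w u (1 - s) :=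
  (AffineMap.lineMap_apply_one_sub _ _ _).symm

theorem edgePt_right {u w : V} (h : u ≠ w) (s : ℝ) : edgePt u w s w = s := by
  simp [edgePt, vtx, AffineMap.lineMap_apply, h]

theorem edgePt_left {u w : V} (h : u ≠ w) (s : ℝ) : edgePt u w s u = 1 - s := by
  rw [edgePt_symm, edgePt_right h.symm]

theorem edgePt_of_ne {u w x : V} (hu : x ≠ u) (hw : x ≠ w) (s : ℝ) : edgePt u w s x = 0 := by
  simp [edgePt, vtx, AffineMap.lineMap_apply, hu, hw]

theorem continuous_edgePt (u w : V) : Continuous (edgePt u w) := AffineMap.lineMap_continuous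

theorem edgePt_injective {u w : V} (h : u ≠ w) : Function.Injective (edgePt u w) := by
  intro s t hst
  rw [← edgePt_right h s, hst, edgePt_right h]

theorem edge_eq_image (u w : V) : edge u w = edgePt u w '' Icc 0 1 :=
  segment_eq_image_lineMap ℝ _ _

theorem openEdge_eq_image (u w : V) : openEdge u w = edgePt u w '' Ioo 0 1 :=
  openSegment_eq_image_lineMap ℝ _ _

theorem edge_symm (u w : V) : edge u w = edge w u := segment_symm ℝ _ _

theorem edgePt_mem_edge (u w : V) {s : ℝ} (hs : s ∈ Icc (0 : ℝ) 1) : edgePt u w s ∈ edge u w :=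
  edge_eq_image u w ▸ mem_image_of_mem _ hs

theorem openEdge_subset_edge (u w : V) : openEdge u w ⊆ edge u w :=
  openSegment_subset_segment ℝ _ _

theorem mem_edge_iff {u w : V} {p : V → ℝ} :
    p ∈ edge u w ↔ p = vtx u ∨ p = vtx w ∨ p ∈ openEdge u w := by
  rw [edge, ← insert_endpoints_openSegment]; rfl

theorem eq_vtx_of_mem_edge {u w : V} (h : u ≠ w) {p : V → ℝ} (hp : p ∈ edge u w)
    (h0 : p u = 0) : p = vtx w := by
  rw [edge_eq_image] at hp
  obtain ⟨s, -, rfl⟩ := hp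
  rw [edgePt_left h, sub_eq_zero] at h0
  rw [← h0, edgePt_one]

theorem vtx_notMem_openEdge {u w x : V} (h : u ≠ w) : vtx x ∉ openEdge u w := by
  rw [openEdge_eq_image]
  rintro ⟨s, hs, hsx⟩
  have hu : 0 < vtx x u := by rw [← hsx, edgePt_left h]; linarith [hs.2]
  have hw : 0 < vtx x w := by rw [← hsx, edgePt_right h]; exact hs.1
  by_cases hxu : x = u
  · subst hxu; simp [vtx, h] at hw
  · simp [vtx, Ne.symm hxu] at hu

end Coordinates

/-! ### The realization of a subgraph. -/

section Points

variable (T : OrderedTree V)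

theorem pointsOn_mono {S S' : Set V} (h : S ⊆ S') : T.pointsOn S ⊆ T.pointsOn S' := by
  rintro p (⟨u, hu, rfl⟩ | ⟨u, hu, w, hw, ha, hp⟩)
  · exact Or.inl ⟨u, h hu, rfl⟩
  · exact Or.inr ⟨u, h hu, w, h hw, ha, hp⟩

theorem pointsOn_subset_points (S : Set V) : T.pointsOn S ⊆ T.points :=
  T.pointsOn_mono (subset_univ S)

theorem vtx_mem_pointsOn {S : Set V} {u : V} (h : u ∈ S) : vtx u ∈ T.pointsOn S :=
  Or.inl ⟨u, h, rfl⟩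

theorem vtx_mem_points (u : V) : vtx u ∈ T.points := T.vtx_mem_pointsOn (mem_univ u)

variable {T}

theorem edge_subset_pointsOn {S : Set V} {u w : V} (ha : T.graph.Adj u w) (hu : u ∈ S)
    (hw : w ∈ S) : edge u w ⊆ T.pointsOn S :=
  fun _ hp => Or.inr ⟨u, hu, w, hw, ha, hp⟩

theorem edge_subset_points {u w : V} (ha : T.graph.Adj u w) : edge u w ⊆ T.points :=
  edge_subset_pointsOn ha (mem_univ _) (mem_univ _)

/-- A point of the realization is a convex combination of at most two vertices of `S`. This turns
questions on how sub-trees meet into questions on coordinates. -/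
theorem apply_eq_zero_of_mem_pointsOn {S : Set V} {u : V} (hu : u ∉ S) {p : V → ℝ}
    (hp : p ∈ T.pointsOn S) : p u = 0 := by
  rcases hp with ⟨x, hx, rfl⟩ | ⟨x, hx, y, hy, -, hp⟩
  · have : u ≠ x := fun h => hu (h ▸ hx)
    simp [vtx, this]
  · rw [edge_eq_image] at hp
    obtain ⟨s, -, rfl⟩ := hp
    exact edgePt_of_ne (by rintro rfl; exact hu hx) (by rintro rfl; exact hu hy) s

theorem mem_edge_of_pos {u w : V} (h : u ≠ w) {p : V → ℝ} (hp : p ∈ T.points)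
    (hu : 0 < p u) (hw : 0 < p w) : p ∈ edge u w := by
  rcases hp with ⟨x, -, rfl⟩ | ⟨x, -, y, -, ha, hp⟩
  · by_cases hxu : u = x
    · subst hxu; simp [vtx, h.symm] at hw
    · simp [vtx, hxu] at hu
  · have key : ∀ z, 0 < p z → z = x ∨ z = y := by
      intro z hz
      by_contra hne
      rw [not_or] at hne
      rw [edge_eq_image] at hp
      obtain ⟨s, -, rfl⟩ := hp
      rw [edgePt_of_ne hne.1 hne.2] at hz
      exact lt_irrefl _ hz
    rcases key u hu with rfl | rfl <;> rcases key w hw with rfl | rfl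
    · exact absurd rfl h
    · exact hp
    · rwa [edge_symm]
    · exact absurd rfl h

theorem isCompact_edge (u w : V) : IsCompact (edge u w) := by
  rw [edge_eq_image]; exact isCompact_Icc.image (continuous_edgePt u w)

variable (T) in
theorem isCompact_pointsOn [Fintype V] (S : Set V) : IsCompact (T.pointsOn S) := by
  have : T.pointsOn S = (⋃ u ∈ S, {vtx u}) ∪
      ⋃ x ∈ {x : V × V | x.1 ∈ S ∧ x.2 ∈ S ∧ T.graph.Adj x.1 x.2}, edge x.1 x.2 := by
    ext p
    simp only [pointsOn, mem_union, mem_iUnion, mem_singleton_iff, mem_ofPred_eq, Prod.exists,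
      exists_prop]
    refine or_congr Iff.rfl ⟨?_, ?_⟩
    · rintro ⟨u, hu, w, hw, ha, hp⟩; exact ⟨u, w, ⟨hu, hw, ha⟩, hp⟩
    · rintro ⟨u, w, ⟨hu, hw, ha⟩, hp⟩; exact ⟨u, hu, w, hw, ha, hp⟩
  rw [this]
  exact ((Set.toFinite S).isCompact_biUnion fun _ _ => isCompact_singleton).union
    ((Set.toFinite _).isCompact_biUnion fun _ _ => isCompact_edge _ _)

/-- An open piece of an edge is open in the tree. -/
theorem image_Icc_mem_nhdsWithin {u w : V} (h : u ≠ w) {a b s : ℝ} (ha : 0 ≤ a) (hb : b ≤ 1)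
    (has : a < s) (hsb : s < b) : edgePt u w '' Icc a b ∈ 𝓝[T.points] (edgePt u w s) := by
  have hO : IsOpen {q : V → ℝ | a < q w ∧ q w < b ∧ 0 < q u} :=
    (isOpen_lt continuous_const (continuous_apply w)).inter
      ((isOpen_lt (continuous_apply w) continuous_const).inter
        (isOpen_lt continuous_const (continuous_apply u)))
  refine mem_nhdsWithin.2 ⟨_, hO, ?_, ?_⟩
  · simp only [mem_ofPred_eq, edgePt_right h, edgePt_left h]
    exact ⟨has, hsb, by linarith⟩
  · rintro q ⟨⟨h1, h2, h3⟩, hq⟩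
    have := mem_edge_of_pos h hq h3 (by linarith)
    rw [edge_eq_image] at this
    obtain ⟨t, -, rfl⟩ := this
    rw [edgePt_right h] at h1 h2
    exact ⟨t, ⟨h1.le, h2.le⟩, rfl⟩

end Points

/-! ### Subsets of the tree that end only at vertices or at one given point. -/

section Full

variable (T : OrderedTree V)

/-- The set `A` of points of the tree ends only at vertices and at `x`. -/
def IsFull (A : Set (V → ℝ)) (x : V → ℝ) : Prop :=
  ∀ q ∈ A, q ≠ x → (∃ u, q = vtx u) ∨ A ∈ 𝓝[T.points] q

variable {T}

theorem IsFull.union {A B : Set (V → ℝ)} {x : V → ℝ} (hA : T.IsFull A x) (hB : T.IsFull B x) :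
    T.IsFull (A ∪ B) x := by
  rintro q (hq | hq) hne
  · exact (hA q hq hne).imp_right fun h => mem_of_superset h subset_union_left
  · exact (hB q hq hne).imp_right fun h => mem_of_superset h subset_union_right

theorem isFull_image_Icc {u w : V} (h : u ≠ w) {s : ℝ} (hs : s ∈ Icc (0 : ℝ) 1) :
    T.IsFull (edgePt u w '' Icc 0 s) (edgePt u w s) := by
  rintro _ ⟨t, ht, rfl⟩ hne
  rcases eq_or_lt_of_le ht.1 with rfl | h0
  · exact Or.inl ⟨u, edgePt_zero u w⟩
  rcases eq_or_lt_of_le ht.2 with rfl | h1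
  · exact absurd rfl hne
  · exact Or.inr (image_Icc_mem_nhdsWithin h le_rfl hs.2 h0 h1)

theorem isFull_edge {u w : V} (h : u ≠ w) (x : V → ℝ) : T.IsFull (edge u w) x := by
  intro q hq _
  by_cases hv : ∃ z, q = vtx z
  · exact Or.inl hv
  · rw [edge_eq_image] at hq ⊢
    exact isFull_image_Icc h (right_mem_Icc.2 zero_le_one) q hq
      fun hqe => hv ⟨w, hqe.trans (edgePt_one u w)⟩

theorem isFull_pointsOn (S : Set V) (x : V → ℝ) : T.IsFull (T.pointsOn S) x := by
  rintro q (⟨u, _, rfl⟩ | ⟨u, hu, w, hw, ha, hq⟩) hne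
  · exact Or.inl ⟨u, rfl⟩
  · exact (isFull_edge ha.ne x q hq hne).imp_right
      fun h => mem_of_superset h (edge_subset_pointsOn ha hu hw)

end Full

/-! ### Sub-trees and the arcs inside them. -/

section Subtrees

variable {T : OrderedTree V}

theorem isArc_image_edgePt {u w : V} (h : u ≠ w) {a b : ℝ} (hab : a ≤ b) :
    IsArc (edgePt u w '' Icc a b) (edgePt u w a) (edgePt u w b) :=
  isArc_image_Icc hab AffineMap.lineMap_continuous.continuousOn (edgePt_injective h).injOn

theorem isArc_edge {u w : V} (h : u ≠ w) : IsArc (edge u w) (vtx u) (vtx w) := by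
  have := isArc_image_edgePt h (zero_le_one' ℝ)
  rwa [edgePt_zero, edgePt_one, ← edge_eq_image] at this

/-- A drawing is only known to be polygonal on whole edges; the two closed parts of an edge have a
single image point in common, so `IsPolygonal.of_union` applies. -/
theorem IsDrawing.isPolygonal_image_Icc [Fintype V] {φ : (V → ℝ) → ℂ} (hφ : T.IsDrawing φ) {u w : V}
    (ha : T.graph.Adj u w) {s : ℝ} (hs : s ∈ Icc (0 : ℝ) 1) :
    IsPolygonal (φ '' (edgePt u w '' Icc 0 s)) := by
  have hsub : edgePt u w '' Icc 0 s ∪ edgePt u w '' Icc s 1 = edge u w := by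
    rw [← image_union, Icc_union_Icc_eq_Icc hs.1 hs.2, edge_eq_image]
  have hpts := edge_subset_points ha
  have hcl : ∀ a b, edgePt u w '' Icc a b ⊆ edge u w → IsClosed (φ '' (edgePt u w '' Icc a b)) :=
    fun a b h => ((isCompact_Icc.image (continuous_edgePt u w)).image_of_continuousOn
      (hφ.continuousOn.mono (h.trans hpts))).isClosed
  have hl : edgePt u w '' Icc 0 s ⊆ edge u w := hsub ▸ subset_union_left
  have hr : edgePt u w '' Icc s 1 ⊆ edge u w := hsub ▸ subset_union_right
  refine IsPolygonal.of_union (C := φ '' (edgePt u w '' Icc s 1)) ?_ (hcl _ _ hl) (hcl _ _ hr) ?_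
  · rw [← image_union, hsub]; exact hφ.polygonal u w ha
  · rw [← hφ.injOn.image_inter (hl.trans hpts) (hr.trans hpts),
      ← image_inter (edgePt_injective ha.ne), Icc_inter_Icc_eq_singleton hs.1 hs.2]
    simp

/-- The arc runs through the edges of the path and then partway along one more edge; keeping `w` off
the path prevents it from running back over itself. -/
theorem exists_arc_of_walk [Fintype V] {G : SimpleGraph V} (hG : G ≤ T.graph) {r u : V} (P : G.Walk r u)
    (hP : P.IsPath) {w : V} (hw : T.graph.Adj u w) (hwP : w ∉ P.support) {s : ℝ}
    (hs : s ∈ Icc (0 : ℝ) 1) :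
    ∃ A, IsArc A (vtx r) (edgePt u w s) ∧ A ⊆ T.pointsOn {y | y ∈ P.support ∨ y = w} ∧
      T.IsFull A (edgePt u w s) ∧ ∀ φ, T.IsDrawing φ → IsPolygonal (φ '' A) := by
  induction P with
  | nil =>
    refine ⟨edgePt _ w '' Icc 0 s, ?_, ?_, isFull_image_Icc hw.ne hs,
      fun φ hφ => hφ.isPolygonal_image_Icc hw hs⟩
    · have := isArc_image_edgePt hw.ne hs.1
      rwa [edgePt_zero] at this
    · refine Subset.trans ?_ (edge_subset_pointsOn hw (by simp) (by simp))
      rw [edge_eq_image]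
      exact image_mono (Icc_subset_Icc le_rfl hs.2)
  | @cons r r₁ u h P ih =>
    rw [SimpleGraph.Walk.cons_isPath_iff] at hP
    rw [SimpleGraph.Walk.support_cons, List.mem_cons, not_or] at hwP
    obtain ⟨A, hA, hAs, hAf, hAp⟩ := ih hP.1 hw hwP.2
    refine ⟨edge r r₁ ∪ A, (isArc_edge h.ne).trans hA ?_, union_subset ?_ ?_,
      (isFull_edge h.ne _).union hAf, fun φ hφ => ?_⟩
    -- The vertices carrying the rest of the arc differ from `r`, so its points have `r`-coordinate
    -- zero and meet the first edge only at its far end.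
    · rintro q ⟨hq, hqA⟩
      refine eq_vtx_of_mem_edge h.ne hq (apply_eq_zero_of_mem_pointsOn ?_ (hAs hqA))
      rintro (h' | h')
      · exact hP.2 h'
      · exact hwP.1 h'.symm
    · exact edge_subset_pointsOn (hG h) (by simp) (by simp)
    · refine hAs.trans (T.pointsOn_mono ?_)
      rintro y (hy | hy)
      · exact Or.inl (by simp [hy])
      · exact Or.inr hy
    · rw [image_union]
      exact (hφ.polygonal r r₁ (hG h)).union (hAp φ hφ)

theorem points_eq_union {v r : V} (h : T.graph.Adj v r) :
    T.points = T.anchored v r ∪ edge v r ∪ T.anchored r v := by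
  refine Subset.antisymm ?_ (union_subset (union_subset (T.pointsOn_subset_points _)
    (edge_subset_points h)) (T.pointsOn_subset_points _))
  rintro p (⟨u, -, rfl⟩ | ⟨x, -, y, -, ha, hp⟩)
  · exact (anchoredVerts_union v r u).imp (fun h => Or.inl (T.vtx_mem_pointsOn h))
      fun h => T.vtx_mem_pointsOn h
  · rcases adj_cases (v := v) (r := r) ha with h | h | ⟨rfl, rfl⟩ | ⟨rfl, rfl⟩
    · exact Or.inl (Or.inl (edge_subset_pointsOn ha h.1 h.2 hp))
    · exact Or.inr (edge_subset_pointsOn ha h.1 h.2 hp)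
    · exact Or.inl (Or.inr hp)
    · exact Or.inl (Or.inr (by rwa [edge_symm]))

theorem eq_vtx_of_mem_edge_anchored {v r : V} (h : T.graph.Adj v r) {p : V → ℝ}
    (hp : p ∈ edge v r) (hpa : p ∈ T.anchored v r) : p = vtx r :=
  eq_vtx_of_mem_edge h.ne hp
    (apply_eq_zero_of_mem_pointsOn (anchor_notMem_anchoredVerts h) hpa)

/-- All coordinates of a common point would vanish, which happens at no point of the realization. -/
theorem disjoint_anchored {v r : V} (h : T.graph.Adj v r) :
    Disjoint (T.anchored v r) (T.anchored r v) := by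
  rw [Set.disjoint_left]
  rintro p hp hp'
  have hd := Set.disjoint_left.1 (disjoint_anchoredVerts h)
  have key : ∀ u : V, p u = 0 := by
    intro u
    by_cases hu : u ∈ T.anchoredVerts v r
    · exact apply_eq_zero_of_mem_pointsOn (hd hu) hp'
    · exact apply_eq_zero_of_mem_pointsOn hu hp
  rcases hp with ⟨x, -, rfl⟩ | ⟨x, -, y, -, ha, hp⟩
  · simpa [vtx] using key x
  · rw [eq_vtx_of_mem_edge ha.ne hp (key x)] at key
    simpa [vtx] using key y

/-- Every point of an anchored sub-tree can be reached from the root by an arc. -/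
theorem exists_arc_anchored [Fintype V] {v r : V} {x : V → ℝ} (hx : x ∈ T.anchored v r) :
    ∃ A, IsArc A (vtx r) x ∧ A ⊆ T.anchored v r ∧ T.IsFull A x ∧
      ∀ φ, T.IsDrawing φ → IsPolygonal (φ '' A) := by
  have hle : T.graph.deleteEdges {s(v, r)} ≤ T.graph := SimpleGraph.deleteEdges_le _
  have key : ∀ u w, u ∈ T.anchoredVerts v r → w ∈ T.anchoredVerts v r → T.graph.Adj u w →
      ∀ s ∈ Icc (0 : ℝ) 1, ∃ A, IsArc A (vtx r) (edgePt u w s) ∧ A ⊆ T.anchored v r ∧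
      T.IsFull A (edgePt u w s) ∧ ∀ φ, T.IsDrawing φ → IsPolygonal (φ '' A) := by
    intro u w hu hw ha s hs
    obtain ⟨P, hP⟩ := SimpleGraph.Reachable.exists_isPath hu
    have hsupp : ∀ y ∈ P.support, y ∈ T.anchoredVerts v r :=
      fun y hy => ⟨P.takeUntil y hy⟩
    -- If the path to `u` already passes through `w`, it is cut at `w`, and the edge is entered from
    -- that end with the reversed parameter.
    by_cases hwP : w ∈ P.support
    · obtain ⟨A, h1, h2, h3, h4⟩ := exists_arc_of_walk hle (P.takeUntil w hwP)
        (hP.takeUntil hwP) ha.symm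
        (SimpleGraph.Walk.endpoint_notMem_support_takeUntil hP hwP ha.ne)
        (s := 1 - s) ⟨by linarith [hs.2], by linarith [hs.1]⟩
      rw [← edgePt_symm] at h1 h3
      refine ⟨A, h1, h2.trans (T.pointsOn_mono ?_), h3, h4⟩
      rintro y (hy | rfl)
      · exact hsupp y (P.support_takeUntil_subset_support hwP hy)
      · exact hu
    · obtain ⟨A, h1, h2, h3, h4⟩ := exists_arc_of_walk hle P hP ha hwP hs
      refine ⟨A, h1, h2.trans (T.pointsOn_mono ?_), h3, h4⟩
      rintro y (hy | rfl)
      · exact hsupp y hy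
      · exact hw
  rcases hx with ⟨u, hu, rfl⟩ | ⟨u, hu, w, hw, ha, hx⟩
  · by_cases hur : u = r
    · subst hur
      refine ⟨{vtx u}, IsArc.refl _, singleton_subset_iff.2 (T.vtx_mem_pointsOn hu), ?_, ?_⟩
      · intro q hq hne; exact absurd hq hne
      · intro φ _; exact isPolygonal_of_finite (by simp)
    -- A vertex other than the root is the point at parameter `0` of the first edge of a walk to the
    -- root.
    · obtain ⟨P⟩ := SimpleGraph.Reachable.symm hu
      cases P with
      | nil => exact absurd rfl hur
      | @cons _ w _ h P =>
        have := key u w hu (SimpleGraph.Reachable.symm ⟨P⟩) (hle h) 0 (by simp)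
        rwa [edgePt_zero] at this
  · rw [edge_eq_image] at hx
    obtain ⟨s, hs, rfl⟩ := hx
    exact key u w hu hw ha s hs

end Subtrees

end OrderedTree

namespace OrderedTree

/-! ### The shrunken copy of the plane. -/

section Shrink

/-- The homothety with ratio `lam` followed by the translation that moves `c` to `t`. -/
noncomputable def shrink (c t : ℂ) (lam : ℝ) : ℂ →ᵃ[ℝ] ℂ :=
  AffineMap.homothety c lam + AffineMap.const ℝ ℂ (t - c)

variable {c t : ℂ} {lam : ℝ}

theorem shrink_apply (z : ℂ) : shrink c t lam z = t + lam * (z - c) := by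
  simp [shrink, AffineMap.homothety_apply]; ring

theorem shrink_base : shrink c t lam c = t := by simp [shrink_apply]

theorem shrink_re (z : ℂ) : (shrink c t lam z).re = t.re + lam * (z.re - c.re) := by
  simp [shrink_apply]

theorem shrink_im (z : ℂ) : (shrink c t lam z).im = t.im + lam * (z.im - c.im) := by
  simp [shrink_apply]

theorem mul_shrink_re (κ : ℝ) (z : ℂ) :
    κ * (shrink c t lam z).re = κ * t.re + lam * (κ * z.re - κ * c.re) := by
  rw [shrink_re]; ring

theorem shrink_sub (z w : ℂ) : shrink c t lam z - shrink c t lam w = lam * (z - w) := by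
  simp only [shrink_apply]; ring

theorem shrink_injective (h : lam ≠ 0) : Function.Injective (shrink c t lam) := by
  intro z w hzw
  have := shrink_sub (c := c) (t := t) (lam := lam) z w
  rw [hzw, sub_self, eq_comm, mul_eq_zero] at this
  exact sub_eq_zero.1 (this.resolve_left (by exact_mod_cast h))

theorem continuous_shrink : Continuous (shrink c t lam) := by
  have : (shrink c t lam : ℂ → ℂ) = fun z => t + lam * (z - c) := funext shrink_apply
  rw [this]; fun_prop

end Shrink

/-! ### The redrawn tree and its properties. -/

variable {V : Type*} [DecidableEq V]

open Classical in
/-- The drawing `φ` with the sub-tree anchored at `v` replaced by its image under `S` and the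
edge `v r` redrawn along `G`. -/
noncomputable def redraw (T : OrderedTree V) (φ : (V → ℝ) → ℂ) (v r : V) (S : ℂ → ℂ)
    (G : ℝ → ℂ) (p : V → ℝ) : ℂ :=
  if p ∈ T.anchored v r then S (φ p) else if p ∈ openEdge v r then G (p r) else φ p

theorem redraw_anchored {T : OrderedTree V} {φ : (V → ℝ) → ℂ} {v r : V} {S : ℂ → ℂ}
    {G : ℝ → ℂ} {p : V → ℝ} (hp : p ∈ T.anchored v r) : redraw T φ v r S G p = S (φ p) :=
  if_pos hp

/-- The data for redrawing `φ`: the sub-tree is shrunk and attached at the point `φ px`, the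
extreme point of the drawing in the direction `κ`, and the edge `v r` is redrawn along `K₀` up to
this point, and then along the shrunken copy of `K₁`. -/
structure IsSurgery (T : OrderedTree V) (φ : (V → ℝ) → ℂ) (v r : V) (κ : ℝ) (px py : V → ℝ)
    (lam : ℝ) (K₀ K₁ : Set (V → ℝ)) (G : ℝ → ℂ) (α σ : ℝ) : Prop where
  drawing : T.IsDrawing φ
  adj : T.graph.Adj v r
  dir_ne : κ ≠ 0
  px_mem : px ∈ T.anchored v r
  py_mem : py ∈ T.points
  py_notMem : py ∉ T.anchored v r
  max : ∀ q ∈ T.points, q ≠ px → κ * (φ q).re < κ * (φ px).re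
  min : ∀ q ∈ T.points, q ≠ py → κ * (φ py).re < κ * (φ q).re
  lam_pos : 0 < lam
  left_subset : K₀ ⊆ T.anchored v r ∪ edge v r
  right_subset : K₁ ⊆ T.anchored r v ∪ edge v r
  px_mem_left : px ∈ K₀
  anchor_mem_left : vtx v ∈ K₀
  py_mem_right : py ∈ K₁
  root_mem_right : vtx r ∈ K₁
  left_preconnected : IsPreconnected K₀
  right_preconnected : IsPreconnected K₁
  left_full : T.IsFull K₀ px
  right_full : T.IsFull K₁ py
  left_polygonal : IsPolygonal (φ '' K₀)
  right_polygonal : IsPolygonal (φ '' K₁)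
  continuousOn_path : ContinuousOn G (Icc 0 1)
  injOn_path : InjOn G (Icc 0 1)
  image_path : G '' Icc 0 1 = φ '' K₀ ∪ shrink (φ py) (φ px) lam '' (φ '' K₁)
  pos : 0 < α
  lt_one : σ < 1
  path_left : ∀ s ∈ Icc 0 α, G s = φ (edgePt v r s)
  path_right : ∀ s ∈ Icc σ 1, G s = shrink (φ py) (φ px) lam (φ (edgePt v r s))

namespace IsSurgery

variable {T : OrderedTree V} {φ : (V → ℝ) → ℂ} {v r : V} {κ : ℝ} {px py : V → ℝ}
    {lam : ℝ} {K₀ K₁ : Set (V → ℝ)} {G : ℝ → ℂ} {α σ : ℝ}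

local notation "𝐒" => shrink (φ py) (φ px) lam
local notation "𝐑" => redraw T φ v r (shrink (φ py) (φ px) lam) G

section

variable (hs : IsSurgery T φ v r κ px py lam K₀ K₁ G α σ)
include hs

theorem px_mem_points : px ∈ T.points := T.pointsOn_subset_points _ hs.px_mem

theorem py_ne {q : V → ℝ} (hq : q ∈ T.anchored v r) : q ≠ py := fun h => hs.py_notMem (h ▸ hq)

theorem px_ne {q : V → ℝ} (hq : q ∈ T.anchored r v) : q ≠ px := fun h =>
  Set.disjoint_left.1 (disjoint_anchored hs.adj) hs.px_mem (h ▸ hq)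

theorem left_subset_points : K₀ ⊆ T.points := hs.left_subset.trans
  (union_subset (T.pointsOn_subset_points _) (edge_subset_points hs.adj))

theorem right_subset_points : K₁ ⊆ T.points := hs.right_subset.trans
  (union_subset (T.pointsOn_subset_points _) (edge_subset_points hs.adj))

theorem path_zero : G 0 = φ (vtx v) := by
  rw [hs.path_left 0 ⟨le_rfl, hs.pos.le⟩, edgePt_zero]

theorem path_one : G 1 = 𝐒 (φ (vtx r)) := by
  rw [hs.path_right 1 ⟨hs.lt_one.le, le_rfl⟩, edgePt_one]

theorem dir_le {q : V → ℝ} (hq : q ∈ T.points) : κ * (φ q).re ≤ κ * (φ px).re := by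
  rcases eq_or_ne q px with rfl | h
  · exact le_rfl
  · exact (hs.max q hq h).le

theorem lt_dir_shrink {q : V → ℝ} (hq : q ∈ T.points) (hne : q ≠ py) :
    κ * (φ px).re < κ * (𝐒 (φ q)).re := by
  rw [mul_shrink_re]
  have := mul_pos hs.lam_pos (sub_pos.2 (hs.min q hq hne))
  linarith

theorem le_dir_shrink {q : V → ℝ} (hq : q ∈ T.points) :
    κ * (φ px).re ≤ κ * (𝐒 (φ q)).re := by
  rcases eq_or_ne q py with rfl | h
  · rw [shrink_base]
  · exact (hs.lt_dir_shrink hq h).le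

/-- The old and the shrunken drawing meet only in the extreme point. -/
theorem eq_of_eq_shrink {p q : V → ℝ} (hp : p ∈ T.points) (hq : q ∈ T.points)
    (h : φ p = 𝐒 (φ q)) : p = px ∧ q = py := by
  have h1 := hs.dir_le hp
  have h2 := hs.le_dir_shrink hq
  constructor
  · by_contra hne
    have := hs.max p hp hne
    rw [h] at this; linarith
  · by_contra hne
    have := hs.lt_dir_shrink hq hne
    rw [← h] at this; linarith

theorem injOn_shrink : InjOn (fun p => 𝐒 (φ p)) T.points :=
  (shrink_injective hs.lam_pos.ne').injOn.comp hs.drawing.injOn (mapsTo_univ _ _)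

theorem redraw_other {p : V → ℝ} (hp : p ∈ T.anchored r v) : 𝐑 p = φ p := by
  have h1 : p ∉ T.anchored v r :=
    fun h => Set.disjoint_left.1 (disjoint_anchored hs.adj) h hp
  have h2 : p ∉ openEdge v r := by
    intro h
    have hpe : p ∈ edge r v := by rw [edge_symm]; exact openEdge_subset_edge v r h
    rw [eq_vtx_of_mem_edge_anchored hs.adj.symm hpe hp] at h
    exact vtx_notMem_openEdge hs.adj.ne h
  simp [redraw, h1, h2]

/-- The coordinate at `r` recovers the parameter on the open edge. The two ends fall under other
branches of `redraw`, which agree with `G` by `path_zero` and `path_one`. -/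
theorem redraw_edgePt {s : ℝ} (hs' : s ∈ Icc (0 : ℝ) 1) : 𝐑 (edgePt v r s) = G s := by
  rcases mem_edge_iff.1 (edgePt_mem_edge v r hs') with h | h | h
  · have : s = 0 := edgePt_injective hs.adj.ne (h.trans (edgePt_zero v r).symm)
    rw [h, this, hs.path_zero,
      hs.redraw_other (T.vtx_mem_pointsOn (root_mem_anchoredVerts r v))]
  · have : s = 1 := edgePt_injective hs.adj.ne (h.trans (edgePt_one v r).symm)
    rw [h, this, hs.path_one,
      redraw_anchored (T.vtx_mem_pointsOn (root_mem_anchoredVerts v r))]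
  · have h1 : edgePt v r s ∉ T.anchored v r := by
      intro h1
      rw [eq_vtx_of_mem_edge_anchored hs.adj (openEdge_subset_edge v r h) h1] at h
      exact vtx_notMem_openEdge hs.adj.ne h
    simp [redraw, h1, h, edgePt_right hs.adj.ne]

theorem image_edge : 𝐑 '' edge v r = φ '' K₀ ∪ 𝐒 '' (φ '' K₁) := by
  rw [← hs.image_path, edge_eq_image, image_image]
  exact image_congr fun s hs' => hs.redraw_edgePt hs'

theorem image_points : 𝐑 '' T.points =
    φ '' (T.anchored r v ∪ K₀) ∪ 𝐒 '' (φ '' (T.anchored v r ∪ K₁)) := by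
  have h1 : 𝐑 '' T.anchored v r = 𝐒 '' (φ '' T.anchored v r) := by
    rw [image_image]; exact image_congr fun p hp => redraw_anchored hp
  have h2 : 𝐑 '' T.anchored r v = φ '' T.anchored r v :=
    image_congr fun p hp => hs.redraw_other hp
  rw [points_eq_union hs.adj, image_union, image_union, h1, h2, hs.image_edge, image_union,
    image_union, image_union]
  ac_rfl

theorem left_all_subset : T.anchored r v ∪ K₀ ⊆ T.points :=
  union_subset (T.pointsOn_subset_points _) hs.left_subset_points

theorem right_all_subset : T.anchored v r ∪ K₁ ⊆ T.points :=
  union_subset (T.pointsOn_subset_points _) hs.right_subset_points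

theorem redraw_cases {p : V → ℝ} (hp : p ∈ T.points) :
    (∃ q ∈ T.anchored r v ∪ K₀, 𝐑 p = φ q) ∨ ∃ q ∈ T.anchored v r ∪ K₁, 𝐑 p = 𝐒 (φ q) := by
  have : 𝐑 p ∈ 𝐑 '' T.points := mem_image_of_mem _ hp
  rw [hs.image_points] at this
  rcases this with ⟨q, hq, h⟩ | ⟨_, ⟨q, hq, rfl⟩, h⟩
  · exact Or.inl ⟨q, hq, h.symm⟩
  · exact Or.inr ⟨q, hq, h.symm⟩

theorem continuousOn_redraw [Fintype V] : ContinuousOn 𝐑 T.points := by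
  have hc := hs.drawing.continuousOn
  rw [points_eq_union hs.adj]
  refine ContinuousOn.union_of_isClosed (ContinuousOn.union_of_isClosed ?_ ?_
    (T.isCompact_pointsOn _).isClosed (isCompact_edge v r).isClosed) ?_
    ((T.isCompact_pointsOn _).isClosed.union (isCompact_edge v r).isClosed)
    (T.isCompact_pointsOn _).isClosed
  · exact (continuous_shrink.comp_continuousOn (hc.mono (T.pointsOn_subset_points _))).congr
      fun p hp => redraw_anchored hp
  · have hmaps : MapsTo (fun p : V → ℝ => p r) (edge v r) (Icc 0 1) := by
      rw [edge_eq_image]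
      rintro _ ⟨s, hs', rfl⟩
      simpa only [edgePt_right hs.adj.ne] using hs'
    refine (hs.continuousOn_path.comp (continuous_apply r).continuousOn hmaps).congr ?_
    rw [edge_eq_image]
    rintro _ ⟨s, hs', rfl⟩
    simp only [Function.comp]
    rw [hs.redraw_edgePt hs', edgePt_right hs.adj.ne]
  · exact (hc.mono (T.pointsOn_subset_points _)).congr fun p hp => hs.redraw_other hp

/-- Two values on the same side of the contact line are compared by injectivity of φ or of its
shrunken copy. Two values from different sides can coincide only at the contact point, which neither
sub-tree attains: `px` is not in the component of `v`, and `py` is not in that of `r`. -/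
theorem injOn_redraw : InjOn 𝐑 T.points := by
  have hsub : ∀ S, T.pointsOn S ⊆ T.points := T.pointsOn_subset_points
  have hG : ∀ s ∈ Icc (0 : ℝ) 1, (∃ q ∈ K₀, φ q = G s) ∨ ∃ q ∈ K₁, 𝐒 (φ q) = G s := by
    intro s hs'
    have : G s ∈ G '' Icc 0 1 := mem_image_of_mem _ hs'
    rw [hs.image_path] at this
    rcases this with ⟨q, hq, h⟩ | ⟨_, ⟨q, hq, rfl⟩, h⟩
    · exact Or.inl ⟨q, hq, h⟩
    · exact Or.inr ⟨q, hq, h⟩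
  have h01 : (0 : ℝ) ∈ Icc (0 : ℝ) 1 := by simp
  have h11 : (1 : ℝ) ∈ Icc (0 : ℝ) 1 := by simp
  have hAE : ∀ p ∈ T.anchored v r, ∀ s ∈ Icc (0 : ℝ) 1, 𝐑 p = 𝐑 (edgePt v r s) →
      p = edgePt v r s := by
    intro p hp s hs' h
    rw [redraw_anchored hp, hs.redraw_edgePt hs'] at h
    rcases hG s hs' with ⟨q, hq, hqs⟩ | ⟨q, hq, hqs⟩
    · exact absurd (hs.eq_of_eq_shrink (hs.left_subset_points hq) (hsub _ hp)
        (hqs.trans h.symm)).2 (hs.py_ne hp)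
    · have hqp : q = p := hs.injOn_shrink (hs.right_subset_points hq) (hsub _ hp)
        (hqs.trans h.symm)
      subst hqp
      have hqr : q = vtx r := (hs.right_subset hq).elim
        (fun h' => absurd h' (Set.disjoint_left.1 (disjoint_anchored hs.adj) hp))
        fun h' => eq_vtx_of_mem_edge_anchored hs.adj h' hp
      subst hqr
      rw [← edgePt_one v r, hs.injOn_path hs' h11 (by rw [← hqs, hs.path_one])]
  have hBE : ∀ p ∈ T.anchored r v, ∀ s ∈ Icc (0 : ℝ) 1, 𝐑 p = 𝐑 (edgePt v r s) →
      p = edgePt v r s := by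
    intro p hp s hs' h
    rw [hs.redraw_other hp, hs.redraw_edgePt hs'] at h
    rcases hG s hs' with ⟨q, hq, hqs⟩ | ⟨q, hq, hqs⟩
    · have hqp : q = p := hs.drawing.injOn (hs.left_subset_points hq) (hsub _ hp)
        (hqs.trans h.symm)
      subst hqp
      have hqr : q = vtx v := (hs.left_subset hq).elim
        (fun h' => absurd hp (Set.disjoint_left.1 (disjoint_anchored hs.adj) h'))
        fun h' => eq_vtx_of_mem_edge_anchored hs.adj.symm (by rwa [edge_symm]) hp
      subst hqr
      rw [← edgePt_zero v r, hs.injOn_path hs' h01 (by rw [← hqs, hs.path_zero])]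
    · exact absurd (hs.eq_of_eq_shrink (hsub _ hp) (hs.right_subset_points hq)
        (h.trans hqs.symm)).1 (hs.px_ne hp)
  have hAB : ∀ p ∈ T.anchored v r, ∀ q ∈ T.anchored r v, 𝐑 p ≠ 𝐑 q := by
    intro p hp q hq h
    rw [redraw_anchored hp, hs.redraw_other hq] at h
    exact hs.py_ne hp (hs.eq_of_eq_shrink (hsub _ hq) (hsub _ hp) h.symm).2
  intro p hp q hq h
  rw [points_eq_union hs.adj, edge_eq_image] at hp hq
  rcases hp with (hp | ⟨s, hs1, rfl⟩) | hp <;> rcases hq with (hq | ⟨s', hs2, rfl⟩) | hq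
  · rw [redraw_anchored hp, redraw_anchored hq] at h
    exact hs.injOn_shrink (hsub _ hp) (hsub _ hq) h
  · exact hAE p hp s' hs2 h
  · exact absurd h (hAB p hp q hq)
  · exact (hAE q hq s hs1 h.symm).symm
  · rw [hs.redraw_edgePt hs1, hs.redraw_edgePt hs2] at h
    rw [hs.injOn_path hs1 hs2 h]
  · exact (hBE q hq s hs1 h.symm).symm
  · exact absurd h.symm (hAB q hq p hp)
  · exact hBE p hp s' hs2 h
  · rw [hs.redraw_other hp, hs.redraw_other hq] at h
    exact hs.drawing.injOn (hsub _ hp) (hsub _ hq) h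

theorem isPolygonal_redraw {x y : V} (h : T.graph.Adj x y) : IsPolygonal (𝐑 '' edge x y) := by
  rcases adj_cases (v := v) (r := r) h with h' | h' | ⟨rfl, rfl⟩ | ⟨rfl, rfl⟩
  · have : 𝐑 '' edge x y = 𝐒 '' (φ '' edge x y) := by
      rw [image_image]
      exact image_congr fun p hp =>
        redraw_anchored (edge_subset_pointsOn h h'.1 h'.2 hp)
    rw [this]
    exact (hs.drawing.polygonal x y h).image _
  · rw [image_congr fun p hp => hs.redraw_other (edge_subset_pointsOn h h'.1 h'.2 hp)]
    exact hs.drawing.polygonal x y h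
  · rw [hs.image_edge]
    exact hs.left_polygonal.union (hs.right_polygonal.image _)
  · rw [edge_symm, hs.image_edge]
    exact hs.left_polygonal.union (hs.right_polygonal.image _)

/-- A vertical line meets the new drawing in points of the old one or in points of its
shrunken copy. -/
theorem vertical_cases (x : ℝ) :
    {z ∈ 𝐑 '' T.points | z.re = x} ⊆ {z ∈ φ '' T.points | z.re = x} ∨
    ∃ x', {z ∈ 𝐑 '' T.points | z.re = x} ⊆ 𝐒 '' {z ∈ φ '' T.points | z.re = x'} := by
  rw [hs.image_points]
  -- The contact line is counted with the original: the only point of the copy on it is the image of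
  -- `py`, which is φ(`px`).
  rcases le_or_gt (κ * x) (κ * (φ px).re) with hx | hx
  · left
    rintro z ⟨⟨q, hq, rfl⟩ | ⟨_, ⟨q, hq, rfl⟩, rfl⟩, rfl⟩
    · exact ⟨⟨q, hs.left_all_subset hq, rfl⟩, rfl⟩
    · rcases eq_or_ne q py with rfl | hne
      · rw [shrink_base]
        exact ⟨⟨px, hs.px_mem_points, rfl⟩, rfl⟩
      · exact absurd hx (not_le.2 (hs.lt_dir_shrink (hs.right_all_subset hq) hne))
  · right
    refine ⟨(φ py).re + (x - (φ px).re) / lam, ?_⟩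
    rintro z ⟨⟨q, hq, rfl⟩ | ⟨_, ⟨q, hq, rfl⟩, rfl⟩, rfl⟩
    · exact absurd (hs.dir_le (hs.left_all_subset hq)) (not_le.2 hx)
    · refine ⟨φ q, ⟨⟨q, hs.right_all_subset hq, rfl⟩, ?_⟩, rfl⟩
      rw [shrink_re]
      have := hs.lam_pos.ne'
      field_simp
      ring

theorem finite_vertical_redraw (x : ℝ) : {z ∈ 𝐑 '' T.points | z.re = x}.Finite := by
  rcases hs.vertical_cases x with h | ⟨x', h⟩
  · exact (hs.drawing.finite_vertical x).subset h
  · exact ((hs.drawing.finite_vertical x').image _).subset h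

theorem height_redraw_le : T.height 𝐑 ≤ T.height φ := by
  refine iSup_le fun x => ?_
  rcases hs.vertical_cases x with h | ⟨x', h⟩
  · exact (encard_le_encard h).trans
      (le_iSup (fun x : ℝ => {z ∈ φ '' T.points | z.re = x}.encard) x)
  · exact ((encard_le_encard h).trans (encard_image_le _ _)).trans
      (le_iSup (fun x : ℝ => {z ∈ φ '' T.points | z.re = x}.encard) x')

/-- A homothety with positive ratio preserves arguments. The redrawn edge starts at `v` along its
old image and ends at `r` along the shrunken one, so only parameters close to the vertex matter. -/
theorem angle_redraw {u w : V} (h : T.graph.Adj u w) :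
    ∀ᶠ s in 𝓝[>] (0 : ℝ), angle 𝐑 u w s = angle φ u w s := by
  have hshrink : ∀ z z' : ℂ, Complex.arg (𝐒 z - 𝐒 z') = Complex.arg (z - z') := by
    intro z z'
    rw [shrink_sub, Complex.arg_real_mul _ hs.lam_pos]
  have hI : ∀ {b : ℝ}, 0 < b → ∀ᶠ s in 𝓝[>] (0 : ℝ), s ∈ Ioo 0 b := fun hb =>
    Ioo_mem_nhdsGT hb
  rcases adj_cases (v := v) (r := r) h with h' | h' | ⟨rfl, rfl⟩ | ⟨rfl, rfl⟩
  · filter_upwards [hI one_pos] with s hs'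
    have h1 : 𝐑 (edgePt u w s) = _ := redraw_anchored (edge_subset_pointsOn h h'.1 h'.2
      (edgePt_mem_edge u w ⟨hs'.1.le, hs'.2.le⟩))
    have h2 : 𝐑 (vtx u) = _ := redraw_anchored (T.vtx_mem_pointsOn h'.1)
    rw [edgePt] at h1
    simp only [angle, h1, h2, hshrink]
  · filter_upwards [hI one_pos] with s hs'
    have h1 := hs.redraw_other (edge_subset_pointsOn h h'.1 h'.2
      (edgePt_mem_edge u w ⟨hs'.1.le, hs'.2.le⟩))
    have h2 := hs.redraw_other (T.vtx_mem_pointsOn h'.1)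
    rw [edgePt] at h1
    simp only [angle, h1, h2]
  · filter_upwards [hI one_pos, hI hs.pos] with s hs' hsα
    have h1 := hs.redraw_edgePt ⟨hs'.1.le, hs'.2.le⟩
    rw [hs.path_left s ⟨hsα.1.le, hsα.2.le⟩] at h1
    have h2 := hs.redraw_other (T.vtx_mem_pointsOn (root_mem_anchoredVerts w u))
    rw [edgePt] at h1
    simp only [angle, h1, h2]
  · filter_upwards [hI one_pos, hI (sub_pos.2 hs.lt_one)] with s hs' hsσ
    have h1 := hs.redraw_edgePt (s := 1 - s) ⟨by linarith [hs'.2], by linarith [hs'.1]⟩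
    rw [hs.path_right (1 - s) ⟨by linarith [hsσ.2], by linarith [hs'.1]⟩, ← edgePt_symm] at h1
    have h2 : redraw T φ w u 𝐒 G (vtx u) = _ :=
      redraw_anchored (T.vtx_mem_pointsOn (root_mem_anchoredVerts w u))
    rw [edgePt] at h1
    simp only [angle, h1, h2, hshrink]

theorem isDrawing_redraw [Fintype V] : T.IsDrawing 𝐑 where
  continuousOn := hs.continuousOn_redraw
  injOn := hs.injOn_redraw
  polygonal _ _ h := hs.isPolygonal_redraw h
  finite_vertical := hs.finite_vertical_redraw
  clockwise u a b c := by
    rw [hs.drawing.clockwise u a b c]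
    refine eventually_congr ?_
    filter_upwards [hs.angle_redraw a.2, hs.angle_redraw b.2, hs.angle_redraw c.2]
      with s ha hb hc
    rw [ha, hb, hc]

/-- The new edge crosses the contact line here. Each of its two halves is a nontrivial connected set
containing the contact point, which is therefore an accumulation point of both, and they lie
strictly on opposite sides. -/
theorem not_isLocalExtrOn : ¬ IsLocalExtrOn Complex.re (𝐑 '' T.points) (φ px) := by
  have hacc : ∀ A : Set ℂ, IsPreconnected A → A.Nontrivial → φ px ∈ A → A ⊆ 𝐑 '' T.points →
      ∃ᶠ z in 𝓝[𝐑 '' T.points] (φ px), z ≠ φ px ∧ z ∈ A := by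
    intro A hA hn hm hsub
    rw [frequently_nhdsWithin_iff]
    exact (accPt_iff_frequently.1 (hA.preperfect_of_nontrivial hn _ hm)).mono
      fun z hz => ⟨hz, hsub hz.2⟩
  have hinj := hs.drawing.injOn
  have h0 : ∃ᶠ z in 𝓝[𝐑 '' T.points] (φ px), κ * z.re < κ * (φ px).re := by
    refine (hacc (φ '' K₀) (hs.left_preconnected.image _
      (hs.drawing.continuousOn.mono hs.left_subset_points)) ?_ ⟨px, hs.px_mem_left, rfl⟩ ?_).mono
      ?_
    · refine ⟨_, ⟨px, hs.px_mem_left, rfl⟩, _, ⟨_, hs.anchor_mem_left, rfl⟩, fun h => ?_⟩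
      exact hs.px_ne (T.vtx_mem_pointsOn (root_mem_anchoredVerts r v))
        (hinj hs.px_mem_points (T.vtx_mem_points v) h).symm
    · rw [hs.image_points]
      exact (image_mono subset_union_right).trans subset_union_left
    · rintro _ ⟨hne, q, hq, rfl⟩
      exact hs.max q (hs.left_subset_points hq) fun h => hne (h ▸ rfl)
  have h1 : ∃ᶠ z in 𝓝[𝐑 '' T.points] (φ px), κ * (φ px).re < κ * z.re := by
    refine (hacc (𝐒 '' (φ '' K₁)) ((hs.right_preconnected.image _
      (hs.drawing.continuousOn.mono hs.right_subset_points)).image _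
      continuous_shrink.continuousOn) ?_ ⟨_, ⟨py, hs.py_mem_right, rfl⟩, shrink_base⟩ ?_).mono ?_
    · refine ⟨_, ⟨_, ⟨py, hs.py_mem_right, rfl⟩, rfl⟩, _, ⟨_, ⟨_, hs.root_mem_right, rfl⟩, rfl⟩,
        fun h => ?_⟩
      exact hs.py_ne (T.vtx_mem_pointsOn (root_mem_anchoredVerts v r))
        (hs.injOn_shrink hs.py_mem (T.vtx_mem_points r) h).symm
    · rw [hs.image_points]
      exact (image_mono (image_mono subset_union_right)).trans subset_union_right
    · rintro _ ⟨hne, _, ⟨q, hq, rfl⟩, rfl⟩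
      refine hs.lt_dir_shrink (hs.right_subset_points hq) fun h => hne ?_
      rw [h, shrink_base]
  have key : (∃ᶠ z in 𝓝[𝐑 '' T.points] (φ px), z.re < (φ px).re) ∧
      ∃ᶠ z in 𝓝[𝐑 '' T.points] (φ px), (φ px).re < z.re := by
    rcases lt_or_gt_of_ne hs.dir_ne with hκ | hκ
    · exact ⟨h1.mono fun z hz => (mul_lt_mul_left_of_neg hκ).1 hz,
        h0.mono fun z hz => (mul_lt_mul_left_of_neg hκ).1 hz⟩
    · exact ⟨h0.mono fun z hz => lt_of_mul_lt_mul_left hz hκ.le,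
        h1.mono fun z hz => lt_of_mul_lt_mul_left hz hκ.le⟩
  rintro (h | h)
  · exact key.1 (h.mono fun z hz => not_lt.2 hz)
  · exact key.2 (h.mono fun z hz => not_lt.2 hz)

/-- The moves of the new drawing are moves of the old one or of its shrunken copy. -/
theorem isMove_redraw [Fintype V] {p : V → ℝ} (hp : T.IsMove 𝐑 p) :
    (∃ q, T.IsMove φ q ∧ 𝐑 p = φ q ∧ κ * (𝐑 p).re < κ * (φ px).re) ∨
    ∃ q, T.IsMove φ q ∧ 𝐑 p = 𝐒 (φ q) ∧ κ * (φ px).re < κ * (𝐑 p).re := by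
  obtain ⟨hpT, ⟨u, rfl⟩ | hext⟩ := hp
  · have hu := T.vtx_mem_points u
    rcases anchoredVerts_union (T := T) v r u with h | h
    · have h' : vtx u ∈ T.anchored v r := T.vtx_mem_pointsOn h
      refine Or.inr ⟨vtx u, ⟨hu, Or.inl ⟨u, rfl⟩⟩, redraw_anchored h', ?_⟩
      rw [redraw_anchored h']
      exact hs.lt_dir_shrink hu (hs.py_ne h')
    · have h' : vtx u ∈ T.anchored r v := T.vtx_mem_pointsOn h
      refine Or.inl ⟨vtx u, ⟨hu, Or.inl ⟨u, rfl⟩⟩, hs.redraw_other h', ?_⟩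
      rw [hs.redraw_other h']
      exact hs.max _ hu (hs.px_ne h')
  · have hext' := IsLocalExtrOn.image_of_isCompact (h := Complex.re) (T.isCompact_pointsOn univ)
      hs.continuousOn_redraw hs.injOn_redraw hpT hext
    change IsLocalExtrOn Complex.re (𝐑 '' T.points) (𝐑 p) at hext'
    have hpt : 𝐑 p ≠ φ px := fun h => hs.not_isLocalExtrOn (by rwa [h] at hext')
    have hcont := hs.drawing.continuousOn
    -- Unless `q` is a vertex, fullness says that a whole neighbourhood of `q` in the tree is mapped
    -- into the new image, by φ or by its shrunken copy. The extremum then pulls back to `q`.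
    rcases hs.redraw_cases hpT with ⟨q, hq, hpq⟩ | ⟨q, hq, hpq⟩
    · have hne : q ≠ px := fun h => hpt (by rw [hpq, h])
      refine Or.inl ⟨q, ⟨hs.left_all_subset hq, ?_⟩, hpq, ?_⟩
      · rcases (isFull_pointsOn _ px).union hs.left_full q hq hne with h | h
        · exact Or.inl h
        · right
          have hsub : φ '' (T.anchored r v ∪ K₀) ⊆ 𝐑 '' T.points := by
            rw [hs.image_points]; exact subset_union_left
          rw [hpq] at hext'
          have ht : Tendsto φ (𝓝[T.points] q) (𝓝[𝐑 '' T.points] (φ q)) := by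
            refine tendsto_nhdsWithin_iff.2 ⟨hcont q (hs.left_all_subset hq), ?_⟩
            filter_upwards [h] with q' hq'
            exact hsub (mem_image_of_mem _ hq')
          exact hext'.imp (fun h => (ht.eventually h).mono fun _ h => h)
            fun h => (ht.eventually h).mono fun _ h => h
      · rw [hpq]; exact hs.max q (hs.left_all_subset hq) hne
    · have hne : q ≠ py := fun h => hpt (by rw [hpq, h, shrink_base])
      refine Or.inr ⟨q, ⟨hs.right_all_subset hq, ?_⟩, hpq, ?_⟩
      · rcases (isFull_pointsOn _ py).union hs.right_full q hq hne with h | h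
        · exact Or.inl h
        · right
          have hsub : 𝐒 '' (φ '' (T.anchored v r ∪ K₁)) ⊆ 𝐑 '' T.points := by
            rw [hs.image_points]; exact subset_union_right
          rw [hpq] at hext'
          have ht : Tendsto (fun q => 𝐒 (φ q)) (𝓝[T.points] q)
              (𝓝[𝐑 '' T.points] (𝐒 (φ q))) := by
            refine tendsto_nhdsWithin_iff.2
              ⟨(continuous_shrink.comp_continuousOn hcont) q (hs.right_all_subset hq), ?_⟩
            filter_upwards [h] with q' hq'
            exact hsub (mem_image_of_mem _ (mem_image_of_mem _ hq'))
          have hmono : ∀ z w : ℂ, (𝐒 z).re ≤ (𝐒 w).re → z.re ≤ w.re := by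
            intro z w hzw
            rw [shrink_re, shrink_re] at hzw
            have := le_of_mul_le_mul_left (by linarith : lam * (z.re - (φ py).re) ≤
              lam * (w.re - (φ py).re)) hs.lam_pos
            linarith
          exact hext'.imp (fun h => (ht.eventually h).mono fun _ h => hmono _ _ h)
            fun h => (ht.eventually h).mono fun _ h => hmono _ _ h
      · rw [hpq]; exact hs.lt_dir_shrink (hs.right_all_subset hq) hne

/-- Moves on different sides are separated strictly by the contact line; on one side equal abscissas
reduce to equal abscissas of moves of φ. -/
theorem distinctMoves_redraw [Fintype V] (h : T.DistinctMoves φ) : T.DistinctMoves 𝐑 := by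
  intro p hp p' hp' heq
  change (𝐑 p).re = (𝐑 p').re at heq
  refine hs.injOn_redraw hp.1 hp'.1 ?_
  rcases hs.isMove_redraw hp with ⟨q, hq, hpq, hlt⟩ | ⟨q, hq, hpq, hlt⟩ <;>
    rcases hs.isMove_redraw hp' with ⟨q', hq', hpq', hlt'⟩ | ⟨q', hq', hpq', hlt'⟩
  · rw [hpq, hpq'] at heq ⊢
    rw [h hq hq' heq]
  · rw [heq] at hlt; exact absurd hlt hlt'.not_gt
  · rw [heq] at hlt; exact absurd hlt hlt'.not_gt
  · rw [hpq, hpq'] at heq ⊢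
    rw [shrink_re, shrink_re] at heq
    have := mul_left_cancel₀ hs.lam_pos.ne' (add_left_cancel heq)
    rw [h hq hq' (sub_left_injective this)]

/-- The new edge passes through the contact point, and it cannot do so at an end: `v` is not `px`,
and `r` is not `py`. -/
theorem mem_openEdge : φ px ∈ 𝐑 '' openEdge v r := by
  have : φ px ∈ 𝐑 '' edge v r := by
    rw [hs.image_edge]; exact Or.inl ⟨px, hs.px_mem_left, rfl⟩
  obtain ⟨p, hp, hpx⟩ := this
  refine ⟨p, ?_, hpx⟩
  rcases mem_edge_iff.1 hp with rfl | rfl | h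
  · have hv := T.vtx_mem_pointsOn (root_mem_anchoredVerts (T := T) r v)
    rw [hs.redraw_other hv] at hpx
    exact absurd (hs.drawing.injOn (T.vtx_mem_points v) hs.px_mem_points hpx) (hs.px_ne hv)
  · have hr := T.vtx_mem_pointsOn (root_mem_anchoredVerts (T := T) v r)
    rw [redraw_anchored hr] at hpx
    exact absurd (hs.eq_of_eq_shrink hs.px_mem_points (T.vtx_mem_points r) hpx.symm).2
      (hs.py_ne hr)
  · exact h

/-- It suffices that the rectangle holds the entire shrunken copy, in its interior up to the contact
point, and that its strip avoids the original up to that point. Whatever the new drawing shows in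
the strip then belongs to the copy. -/
theorem isBubbling [Fintype V] {a b c d : ℝ} (hab : a < b) (side : (φ px).re = a ∨ (φ px).re = b)
    (him : (φ px).im ∈ Ioo c d)
    (hin : ∀ q ∈ T.points, q ≠ py → 𝐒 (φ q) ∈ Ioo a b ×ℂ Ioo c d)
    (hout : ∀ q ∈ T.points, q ≠ px → (φ q).re ∉ Icc a b) :
    T.IsBubbling φ 𝐑 v r (φ px) a b c d := by
  have hcd : c < d := him.1.trans him.2
  have htQ : φ px ∈ Icc a b ×ℂ Icc c d := by
    refine ⟨?_, Ioo_subset_Icc_self him⟩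
    rcases side with h | h
    · exact ⟨h.ge, h.le.trans hab.le⟩
    · exact ⟨hab.le.trans h.ge, h.le⟩
  have hsub : Ioo a b ×ℂ Ioo c d ⊆ Icc a b ×ℂ Icc c d := fun z hz =>
    ⟨Ioo_subset_Icc_self hz.1, Ioo_subset_Icc_self hz.2⟩
  have hinQ : ∀ q ∈ T.points, 𝐒 (φ q) ∈ Icc a b ×ℂ Icc c d := by
    intro q hq
    rcases eq_or_ne q py with rfl | hne
    · rwa [shrink_base]
    · exact hsub (hin q hq hne)
  have hclosed : IsClosed (Icc a b ×ℂ Icc c d) := isClosed_Icc.reProdIm isClosed_Icc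
  refine ⟨hs.isDrawing_redraw, hs.height_redraw_le, ⟨hab, hcd, side, him, hs.mem_openEdge, ?_,
    ?_, ?_, ?_⟩, ?_, ?_⟩
  · intro p hp
    rw [redraw_anchored hp]
    exact hin p (T.pointsOn_subset_points _ hp) (hs.py_ne hp)
  · intro p hp hpQ
    have hB : p ∉ T.anchored r v := by
      intro hB
      rw [hs.redraw_other hB] at hpQ
      exact hout p hp (hs.px_ne hB) hpQ.1
    rw [points_eq_union hs.adj] at hp
    rcases hp with (hp | hp) | hp
    · exact Or.inl hp
    · rcases mem_edge_iff.1 hp with rfl | rfl | h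
      · exact absurd (T.vtx_mem_pointsOn (root_mem_anchoredVerts r v)) hB
      · exact Or.inl (T.vtx_mem_pointsOn (root_mem_anchoredVerts v r))
      · exact Or.inr h
    · exact absurd hp hB
  · refine Subset.antisymm ?_ ?_
    · rintro _ ⟨⟨p, hp, rfl⟩, hf⟩
      rcases hs.redraw_cases hp with ⟨q, hq, h⟩ | ⟨q, hq, h⟩
      · rw [h] at hf ⊢
        by_contra hne
        exact hout q (hs.left_all_subset hq) (fun h => hne (h ▸ rfl))
          (hclosed.frontier_subset hf).1
      · rw [h] at hf ⊢
        rcases eq_or_ne q py with rfl | hne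
        · rw [shrink_base]; rfl
        · have hi : 𝐒 (φ q) ∈ interior (Icc a b ×ℂ Icc c d) := by
            rw [Complex.interior_reProdIm, interior_Icc, interior_Icc]
            exact hin q (hs.right_all_subset hq) hne
          exact absurd hi hf.2
    · rintro _ rfl
      refine ⟨image_mono (openEdge_subset_edge v r |>.trans (edge_subset_points hs.adj))
        hs.mem_openEdge, ?_⟩
      rw [Complex.frontier_reProdIm, frontier_Icc hab.le, isClosed_Icc.closure_eq]
      refine Or.inr ⟨?_, ?_⟩
      · simpa using side
      · rw [isClosed_Icc.closure_eq]; exact htQ.2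
  · intro p hp hpQ hpx
    rcases hs.redraw_cases hp.1 with ⟨q, hq, h⟩ | ⟨q, hq, h⟩
    · rcases eq_or_ne q px with rfl | hne
      · exact hpQ (by rwa [h])
      · exact hout q (hs.left_all_subset hq) hne (h ▸ hpx)
    · exact hpQ (h ▸ hinQ q (hs.right_all_subset hq))
  · intro p hp h1 h2
    simp [redraw, h1, h2]
  · rw [hs.image_edge]
    rintro _ ⟨⟨q, hq, rfl⟩ | ⟨_, ⟨q, hq, rfl⟩, rfl⟩, hz⟩
    · exact ⟨q, hs.left_subset hq, rfl⟩
    · exact absurd (hinQ q (hs.right_subset_points hq)) hz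

end

end IsSurgery

end OrderedTree

/-! ### Existence of the surgery and of the bubbling. -/

namespace OrderedTree

variable {V : Type*} [DecidableEq V] {T : OrderedTree V}

theorem image_edgePt_symm (u w : V) (a b : ℝ) :
    edgePt u w '' Icc a b = edgePt w u '' Icc (1 - b) (1 - a) := by
  have : edgePt u w = edgePt w u ∘ fun s => 1 - s := funext (edgePt_symm u w)
  rw [this, image_comp, image_const_sub_Icc]

theorem image_edgePt_subset (u w : V) {a b : ℝ} (ha : 0 ≤ a) (hb : b ≤ 1) :
    edgePt u w '' Icc a b ⊆ edge u w := by
  rw [edge_eq_image]; exact image_mono (Icc_subset_Icc ha hb)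

theorem image_edgePt_inter_subset {u w : V} (h : u ≠ w) (a b c : ℝ) :
    edgePt u w '' Icc a b ∩ edgePt u w '' Icc b c ⊆ {edgePt u w b} := by
  rintro _ ⟨⟨s, hs, rfl⟩, t, ht, hst⟩
  rw [edgePt_injective h hst] at ht
  rw [le_antisymm hs.2 ht.1]; rfl

/-- The part `M` of an arc that ends with the part of the edge `v r` after the parameter `σ`. -/
structure IsTail (T : OrderedTree V) (v r : V) (x : V → ℝ) (σ : ℝ) (M : Set (V → ℝ)) :
    Prop where
  isArc : IsArc M x (edgePt v r σ)
  subset : M ⊆ T.anchored r v ∪ edge v r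
  inter_subset : M ∩ edgePt v r '' Icc σ 1 ⊆ {edgePt v r σ}
  isFull : T.IsFull (M ∪ edgePt v r '' Icc σ 1) x
  isPolygonal : ∀ φ, T.IsDrawing φ → IsPolygonal (φ '' (M ∪ edgePt v r '' Icc σ 1))

/-- An arc inside the component of `v` from `x` to `v`, continued along the edge up to `σ`. With the
remaining piece it covers the whole edge, so no fullness is lost at the cut. -/
theorem exists_isTail_of_mem_anchored [Fintype V] {v r : V} (h : T.graph.Adj v r) {x : V → ℝ}
    (hx : x ∈ T.anchored r v) {σ : ℝ} (h0 : 0 < σ) (h1 : σ < 1) :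
    ∃ M, T.IsTail v r x σ M := by
  obtain ⟨A, hA, hAs, hAf, hAp⟩ := exists_arc_anchored hx
  have hE : edgePt v r '' Icc 0 σ ⊆ edge v r := image_edgePt_subset v r le_rfl h1.le
  have hmeet : ∀ q ∈ A, q ∈ edge v r → q = vtx v := fun q hq hqe =>
    eq_vtx_of_mem_edge_anchored h.symm (by rwa [edge_symm]) (hAs hq)
  have hunion : A ∪ edgePt v r '' Icc 0 σ ∪ edgePt v r '' Icc σ 1 = A ∪ edge v r := by
    rw [union_assoc, ← image_union, Icc_union_Icc_eq_Icc h0.le h1.le, edge_eq_image]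
  refine ⟨A ∪ edgePt v r '' Icc 0 σ, ?_, union_subset_union hAs hE, ?_, ?_, ?_⟩
  · refine hA.symm.trans (y := vtx v) ?_ fun q hq => hmeet q hq.1 (hE hq.2)
    have := isArc_image_edgePt h.ne h0.le
    rwa [edgePt_zero] at this
  · rw [union_inter_distrib_right]
    refine union_subset ?_ (image_edgePt_inter_subset h.ne 0 σ 1)
    rintro _ ⟨hqA, t, ht, rfl⟩
    have := hmeet _ hqA (edgePt_mem_edge v r ⟨h0.le.trans ht.1, ht.2⟩)
    rw [← edgePt_zero v r] at this
    have := edgePt_injective h.ne this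
    linarith [ht.1]
  · rw [hunion]; exact hAf.union (isFull_edge h.ne x)
  · intro φ hφ
    rw [hunion, image_union]
    exact (hAp φ hφ).union (hφ.polygonal v r h)

/-- The point may also lie on the edge itself, at a parameter `τ < 1`; the tail then starts there
and is cut halfway between `τ` and `1`. The bound `1 / 3 < σ` reserves the first third of the edge
for its unchanged beginning and leaves an interval for the detour. -/
theorem exists_isTail [Fintype V] {v r : V} (h : T.graph.Adj v r) {x : V → ℝ}
    (hx : x ∈ T.points) (hx' : x ∉ T.anchored v r) :
    ∃ σ ∈ Ioo (1 / 3 : ℝ) 1, ∃ M, T.IsTail v r x σ M := by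
  by_cases hxB : x ∈ T.anchored r v
  · exact ⟨1 / 2, by norm_num, exists_isTail_of_mem_anchored h hxB (by norm_num) (by norm_num)⟩
  have hxe : x ∈ edge v r := by
    rw [points_eq_union h] at hx
    exact (hx.resolve_right hxB).resolve_left hx'
  rw [edge_eq_image] at hxe
  obtain ⟨τ, hτ, rfl⟩ := hxe
  have hτ1 : τ < 1 := lt_of_le_of_ne hτ.2 fun he => hx' (by
    rw [he, edgePt_one]; exact T.vtx_mem_pointsOn (root_mem_anchoredVerts v r))
  have hunion : edgePt v r '' Icc τ ((1 + τ) / 2) ∪ edgePt v r '' Icc ((1 + τ) / 2) 1 =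
      edgePt r v '' Icc 0 (1 - τ) := by
    rw [← image_union, Icc_union_Icc_eq_Icc (by linarith) (by linarith), image_edgePt_symm,
      sub_self]
  have hmem : 1 - τ ∈ Icc (0 : ℝ) 1 := ⟨by linarith, by linarith [hτ.1]⟩
  refine ⟨(1 + τ) / 2, ⟨by linarith [hτ.1], by linarith⟩, edgePt v r '' Icc τ ((1 + τ) / 2),
    isArc_image_edgePt h.ne (by linarith), ?_, image_edgePt_inter_subset h.ne _ _ _, ?_, ?_⟩
  · exact (image_edgePt_subset v r hτ.1 (by linarith)).trans subset_union_right
  · rw [hunion, edgePt_symm]; exact isFull_image_Icc h.ne' hmem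
  · intro φ hφ
    rw [hunion]; exact hφ.isPolygonal_image_Icc h.symm hmem

/-- The data for redrawing a tree exist. -/
theorem exists_isSurgery [Fintype V] {φ : (V → ℝ) → ℂ} (hφ : T.IsDrawing φ) {v r : V}
    (h : T.graph.Adj v r) {κ : ℝ} (hκ : κ ≠ 0) {px py : V → ℝ} (hpx : px ∈ T.anchored v r)
    (hpy : py ∈ T.points) (hpy' : py ∉ T.anchored v r)
    (hmax : ∀ q ∈ T.points, q ≠ px → κ * (φ q).re < κ * (φ px).re)
    (hmin : ∀ q ∈ T.points, q ≠ py → κ * (φ py).re < κ * (φ q).re) {lam : ℝ}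
    (hlam : 0 < lam) :
    ∃ K₀ K₁ G α σ, IsSurgery T φ v r κ px py lam K₀ K₁ G α σ := by
  obtain ⟨σ, ⟨hσ0, hσ1⟩, M₁, hM₁⟩ := exists_isTail h hpy hpy'
  -- The tail lemma is used for the reversed edge; parameter `2 / 3` from `r` is `1 / 3` from `v`.
  obtain ⟨M₀, hM₀⟩ := exists_isTail_of_mem_anchored h.symm hpx (σ := 2 / 3) (by norm_num)
    (by norm_num)
  have hpart : edgePt r v '' Icc (2 / 3) 1 = edgePt v r '' Icc 0 (1 / 3) := by
    rw [image_edgePt_symm]; norm_num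
  have hpt : edgePt r v (2 / 3) = edgePt v r (1 / 3) := by
    rw [edgePt_symm]; norm_num
  obtain ⟨hA₀, hs₀, hi₀, hf₀, hp₀⟩ := hM₀
  obtain ⟨hA₁, hs₁, hi₁, hf₁, hp₁⟩ := hM₁
  rw [hpart] at hi₀ hf₀ hp₀
  rw [hpt] at hi₀ hA₀
  rw [edge_symm] at hs₀
  set E₀ := edgePt v r '' Icc 0 (1 / 3) with hE₀
  set E₁ := edgePt v r '' Icc σ 1 with hE₁
  set S := shrink (φ py) (φ px) lam with hS
  have hE₀s : E₀ ⊆ edge v r := image_edgePt_subset v r le_rfl (by norm_num)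
  have hE₁s : E₁ ⊆ edge v r := image_edgePt_subset v r (by linarith) le_rfl
  have hedge := edge_subset_points h
  have hsub₀ : M₀ ⊆ T.points :=
    hs₀.trans (union_subset (T.pointsOn_subset_points _) hedge)
  have hsub₁ : M₁ ⊆ T.points :=
    hs₁.trans (union_subset (T.pointsOn_subset_points _) hedge)
  have hpxT : px ∈ T.points := T.pointsOn_subset_points _ hpx
  have hSi : Function.Injective S := shrink_injective hlam.ne'
  have hSφi : InjOn (fun p => S (φ p)) T.points := hSi.injOn.comp hφ.injOn (mapsTo_univ _ _)
  have hSc : Continuous S := continuous_shrink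
  -- This is the content of `IsSurgery.eq_of_eq_shrink`, needed here to build the surgery in the
  -- first place.
  have hmeet : ∀ p ∈ T.points, ∀ q ∈ T.points, φ p = S (φ q) → p = px ∧ q = py := by
    intro p hp q hq hpq
    have hre : κ * (φ p).re = κ * (φ px).re + lam * (κ * (φ q).re - κ * (φ py).re) := by
      rw [hpq, hS, mul_shrink_re]
    have hq0 : 0 ≤ κ * (φ q).re - κ * (φ py).re := by
      by_cases hne : q = py
      · rw [hne, sub_self]
      · exact (sub_pos.2 (hmin q hq hne)).le
    have hppx : p = px := by
      by_contra hne
      have := hmax p hp hne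
      have := mul_nonneg hlam.le hq0
      linarith
    refine ⟨hppx, ?_⟩
    by_contra hne
    have := mul_pos hlam (sub_pos.2 (hmin q hq hne))
    rw [hppx] at hre
    linarith
  have hpxE₀ : ∀ s ∈ Icc (0 : ℝ) (1 / 3), edgePt v r s ≠ px := by
    intro s hs he
    have := eq_vtx_of_mem_edge_anchored h (hE₀s (mem_image_of_mem _ hs)) (he ▸ hpx)
    rw [← edgePt_one v r] at this
    have := edgePt_injective h.ne this
    linarith [hs.2]
  have h3 : (1 / 3 : ℝ) ∈ Icc (0 : ℝ) (1 / 3) := by norm_num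
  -- The detour: from the end of the first third to `px` in the original, then from `py` to the cut
  -- `σ` in the copy. It is squeezed into the parameters between `1 / 3` and `σ`.
  have hN : IsArc (φ '' M₀ ∪ S '' (φ '' M₁)) (φ (edgePt v r (1 / 3)))
      (S (φ (edgePt v r σ))) := by
    refine (hA₀.symm.image (hφ.continuousOn.mono hsub₀) (hφ.injOn.mono hsub₀)).trans
      (y := φ px) ?_ ?_
    · have := (hA₁.image (hφ.continuousOn.mono hsub₁) (hφ.injOn.mono hsub₁)).image
        hSc.continuousOn hSi.injOn
      rwa [hS, shrink_base, ← hS] at this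
    · rintro _ ⟨⟨q, hq, rfl⟩, _, ⟨q', hq', rfl⟩, he⟩
      rw [(hmeet q (hsub₀ hq) q' (hsub₁ hq') he.symm).1]; rfl
  have hσE : edgePt v r σ ∈ E₁ := mem_image_of_mem _ ⟨le_rfl, hσ1.le⟩
  have hne : φ (edgePt v r (1 / 3)) ≠ S (φ (edgePt v r σ)) := fun he =>
    hpxE₀ _ h3 (hmeet _ (hedge (hE₀s (mem_image_of_mem _ h3))) _ (hedge (hE₁s hσE)) he).1
  obtain ⟨g, hgc, hgi, hgim, hg0, hg1⟩ := hN.exists_parametrization hne hσ0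
  have hmap₀ : MapsTo (edgePt v r) (Icc 0 (1 / 3)) T.points :=
    fun s hs => hedge (hE₀s (mem_image_of_mem _ hs))
  have hmap₁ : MapsTo (edgePt v r) (Icc σ 1) T.points :=
    fun s hs => hedge (hE₁s (mem_image_of_mem _ hs))
  have hcE := (continuous_edgePt v r).continuousOn (s := Icc σ 1)
  have himE₁ : (fun s => S (φ (edgePt v r s))) '' Icc σ 1 = S '' (φ '' E₁) := by
    rw [hE₁, image_image, image_image]
  have himE₀ : (fun s => φ (edgePt v r s)) '' Icc 0 (1 / 3) = φ '' E₀ := by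
    rw [hE₀, image_image]
  set g₁ := glue σ g fun s => S (φ (edgePt v r s)) with hg₁
  have hg₁im : g₁ '' Icc (1 / 3) 1 = φ '' M₀ ∪ S '' (φ '' (M₁ ∪ E₁)) := by
    rw [hg₁, image_glue hσ0.le hσ1.le hg1, hgim, himE₁, union_assoc, image_union, image_union]
  have hg₁c : ContinuousOn g₁ (Icc (1 / 3) 1) :=
    continuousOn_glue hσ0.le hσ1.le hgc
      (hSc.comp_continuousOn (hφ.continuousOn.comp hcE hmap₁)) hg1
  have hg₁i : InjOn g₁ (Icc (1 / 3) 1) := by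
    refine injOn_glue hσ0.le hσ1.le hgi
      (hSφi.comp (edgePt_injective h.ne).injOn hmap₁) hg1 ?_
    rw [hgim, himE₁, hg1]
    rintro _ ⟨⟨q, hq, rfl⟩ | ⟨_, ⟨q, hq, rfl⟩, rfl⟩, _, ⟨q', hq', rfl⟩, he⟩
    · have hq2 := (hmeet q (hsub₀ hq) q' (hedge (hE₁s hq')) he.symm).2
      have : q' = edgePt v r σ := hi₁ ⟨hq2 ▸ hA₁.left_mem, hq'⟩
      rw [← he, this]; rfl
    · have : q' = q := hSφi (hedge (hE₁s hq')) (hsub₁ hq) he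
      subst this
      have : q' = edgePt v r σ := hi₁ ⟨hq, hq'⟩
      rw [this]; rfl
  have hg₁0 : φ (edgePt v r (1 / 3)) = g₁ (1 / 3) := by
    rw [hg₁, glue_eqOn_left σ g _ hσ0.le, hg0]
  refine ⟨E₀ ∪ M₀, M₁ ∪ E₁, glue (1 / 3) (fun s => φ (edgePt v r s)) g₁, 1 / 3, σ, ?_⟩
  have hE₁A : IsArc E₁ (edgePt v r σ) (vtx r) := by
    rw [← edgePt_one v r]; exact isArc_image_edgePt h.ne hσ1.le
  have hE₀A : IsArc E₀ (vtx v) (edgePt v r (1 / 3)) := by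
    rw [← edgePt_zero v r]; exact isArc_image_edgePt h.ne (by norm_num)
  refine
    { drawing := hφ
      adj := h
      dir_ne := hκ
      px_mem := hpx
      py_mem := hpy
      py_notMem := hpy'
      max := hmax
      min := hmin
      lam_pos := hlam
      left_subset := union_subset (hE₀s.trans subset_union_right) hs₀
      right_subset := union_subset hs₁ (hE₁s.trans subset_union_right)
      px_mem_left := Or.inr hA₀.left_mem
      anchor_mem_left := Or.inl hE₀A.left_mem
      py_mem_right := Or.inl hA₁.left_mem
      root_mem_right := Or.inr hE₁A.right_mem
      left_preconnected := (hE₀A.trans hA₀.symm (by rwa [inter_comm])).isPreconnected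
      right_preconnected := (hA₁.trans hE₁A hi₁).isPreconnected
      left_full := by rwa [union_comm]
      right_full := hf₁
      left_polygonal := by rw [union_comm]; exact hp₀ φ hφ
      right_polygonal := hp₁ φ hφ
      continuousOn_path := continuousOn_glue (by norm_num) (by norm_num)
        (hφ.continuousOn.comp (continuous_edgePt v r).continuousOn hmap₀) hg₁c hg₁0
      injOn_path := ?_
      image_path := ?_
      pos := by norm_num
      lt_one := hσ1
      path_left := fun s hs => glue_eqOn_left _ _ _ hs.2
      path_right := fun s hs => ?_ }
  · refine injOn_glue (by norm_num) (by norm_num)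
      (hφ.injOn.comp (edgePt_injective h.ne).injOn hmap₀) hg₁i hg₁0 ?_
    rw [hg₁im, himE₀]
    rintro _ ⟨⟨_, ⟨s, hs, rfl⟩, rfl⟩, ⟨q, hq, he⟩ | ⟨_, ⟨q, hq, rfl⟩, he⟩⟩
    · have : q = edgePt v r s := hφ.injOn (hsub₀ hq) (hmap₀ hs) he
      subst this
      have : edgePt v r s = edgePt v r (1 / 3) := hi₀ ⟨hq, mem_image_of_mem _ hs⟩
      rw [this]; rfl
    · exact absurd (hmeet _ (hmap₀ hs) q
        (hq.elim (fun hq => hsub₁ hq) fun hq => hedge (hE₁s hq)) he.symm).1 (hpxE₀ s hs)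
  · rw [image_glue (by norm_num) (by norm_num) hg₁0, hg₁im, himE₀, image_union φ E₀ M₀,
      union_assoc]
  · rw [glue_eqOn_right hg₁0 (hσ0.le.trans hs.1), hg₁, glue_eqOn_right hg1 hs.1]

/-- The bubbling of a sub-tree at an extreme point, to the left or to the right of it. -/
theorem exists_isBubbling [Fintype V] {φ : (V → ℝ) → ℂ} (hφ : T.IsDrawing φ) {v r : V}
    (h : T.graph.Adj v r) {κ : ℝ} (hκ : κ ≠ 0) {px py : V → ℝ} (hpx : px ∈ T.anchored v r)
    (hpy : py ∈ T.points) (hpy' : py ∉ T.anchored v r)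
    (hmax : ∀ q ∈ T.points, q ≠ px → κ * (φ q).re < κ * (φ px).re)
    (hmin : ∀ q ∈ T.points, q ≠ py → κ * (φ py).re < κ * (φ q).re) {ε : ℝ} (hε : 0 < ε)
    {a b : ℝ} (hab : b - a = ε)
    (hside : 0 < κ ∧ (φ px).re = a ∨ κ < 0 ∧ (φ px).re = b) :
    ∃ φ', T.IsBubbling φ φ' v r (φ px) a b ((φ px).im - ε) ((φ px).im + ε) ∧
      (T.DistinctMoves φ → T.DistinctMoves φ') := by
  obtain ⟨R, hR⟩ := ((T.isCompact_pointsOn univ).image_of_continuousOn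
    hφ.continuousOn).isBounded.subset_closedBall (φ py)
  have hR' : ∀ q ∈ T.points, ‖φ q - φ py‖ ≤ R := fun q hq => by
    rw [← dist_eq_norm]; exact hR (mem_image_of_mem _ hq)
  have hR0 : 0 ≤ R := (norm_nonneg _).trans (hR' py hpy)
  -- Every point of the drawing is within `R` of φ(`py`), so this ratio puts the copy strictly
  -- within `ε` of the contact point; adding `1` also covers `R = 0`.
  have hlam : 0 < ε / (R + 1) := by positivity
  have hsmall : ∀ q ∈ T.points, ∀ x : ℝ, |x| ≤ ‖φ q - φ py‖ → |ε / (R + 1) * x| < ε := by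
    intro q hq x hx
    rw [abs_mul, abs_of_pos hlam]
    calc ε / (R + 1) * |x| ≤ ε / (R + 1) * R :=
          mul_le_mul_of_nonneg_left (hx.trans (hR' q hq)) hlam.le
      _ < ε / (R + 1) * (R + 1) := mul_lt_mul_of_pos_left (by linarith) hlam
      _ = ε := by field_simp
  obtain ⟨K₀, K₁, G, α, σ, hs⟩ := exists_isSurgery hφ h hκ hpx hpy hpy' hmax hmin hlam
  refine ⟨_, hs.isBubbling (by linarith) (hside.imp And.right And.right)
    ⟨by linarith, by linarith⟩ ?_ ?_, hs.distinctMoves_redraw⟩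
  · intro q hq hne
    have hre := abs_lt.1 (hsmall q hq (φ q - φ py).re (Complex.abs_re_le_norm _))
    have him := abs_lt.1 (hsmall q hq (φ q - φ py).im (Complex.abs_im_le_norm _))
    rw [Complex.sub_re] at hre
    rw [Complex.sub_im] at him
    have hmin' := hmin q hq hne
    refine ⟨?_, ?_⟩
    · change (shrink _ _ _ _).re ∈ Ioo a b
      rw [shrink_re]
      rcases hside with ⟨hκ', rfl⟩ | ⟨hκ', rfl⟩
      · have := mul_pos hlam (sub_pos.2 (lt_of_mul_lt_mul_left hmin' hκ'.le))
        exact ⟨by linarith, by linarith⟩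
      · have := mul_pos hlam (sub_pos.2 ((mul_lt_mul_left_of_neg hκ').1 hmin'))
        exact ⟨by linarith, by linarith⟩
    · change (shrink _ _ _ _).im ∈ Ioo _ _
      rw [shrink_im]
      exact ⟨by linarith, by linarith⟩
  · intro q hq hne hmem
    have hmax' := hmax q hq hne
    rcases hside with ⟨hκ', rfl⟩ | ⟨hκ', rfl⟩
    · exact absurd hmem.1 (not_le.2 (lt_of_mul_lt_mul_left hmax' hκ'.le))
    · exact absurd hmem.2 (not_le.2 ((mul_lt_mul_left_of_neg hκ').1 hmax'))

end OrderedTree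

/-! ### The two directions of the lemma. -/

theorem mainTheorem6 {V : Type*} [Fintype V] [DecidableEq V] (T : OrderedTree V)
    (φ : (V → ℝ) → ℂ) (hφ : T.IsDrawing φ)
    (v r : V) (hvr : T.graph.Adj v r)
    (pl pr : V → ℝ) (hpl : pl ∈ T.points) (hpr : pr ∈ T.points)
    (hleft : ∀ q ∈ T.points, q ≠ pl → (φ pl).re < (φ q).re)
    (hright : ∀ q ∈ T.points, q ≠ pr → (φ q).re < (φ pr).re)
    (hone : Xor (pl ∈ T.anchored v r) (pr ∈ T.anchored v r)) :
    (pr ∈ T.anchored v r → ∀ ε > 0, ∃ (φ' : (V → ℝ) → ℂ) (a b c d : ℝ),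
      T.IsBubbling φ φ' v r (φ pr) a b c d ∧ (φ pr).re = a ∧ b - a < ε ∧ d - c < ε ∧
      (T.DistinctMoves φ → T.DistinctMoves φ')) ∧
    (pl ∈ T.anchored v r → ∀ ε > 0, ∃ (φ' : (V → ℝ) → ℂ) (a b c d : ℝ),
      T.IsBubbling φ φ' v r (φ pl) a b c d ∧ (φ pl).re = b ∧ b - a < ε ∧ d - c < ε ∧
      (T.DistinctMoves φ → T.DistinctMoves φ')) := by
  constructor
  · intro hmem ε hε
    have hnot : pl ∉ T.anchored v r := fun h => hone.elim (fun h' => h'.2 hmem) fun h' => h'.2 h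
    -- With `ε / 3` the rectangle has width `ε / 3` and height `2 * ε / 3`, both below `ε`.
    obtain ⟨φ', hb, hd⟩ := OrderedTree.exists_isBubbling hφ hvr one_ne_zero hmem hpl hnot
      (by simpa using hright) (by simpa using hleft) (show 0 < ε / 3 by positivity)
      (a := (φ pr).re) (b := (φ pr).re + ε / 3) (by ring) (Or.inl ⟨one_pos, rfl⟩)
    exact ⟨φ', _, _, _, _, hb, rfl, by linarith, by linarith, hd⟩
  · intro hmem ε hε
    have hnot : pr ∉ T.anchored v r := fun h => hone.elim (fun h' => h'.2 h) fun h' => h'.2 hmem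
    -- The direction `-1` exchanges the roles of the two extreme points.
    obtain ⟨φ', hb, hd⟩ := OrderedTree.exists_isBubbling hφ hvr (neg_ne_zero.2 one_ne_zero) hmem
      hpr hnot (by simpa using hleft) (by simpa using hright) (show 0 < ε / 3 by positivity)
      (a := (φ pl).re - ε / 3) (b := (φ pl).re) (by ring) (Or.inr ⟨by norm_num, rfl⟩)
    exact ⟨φ', _, _, _, _, hb, rfl, by linarith, by linarith, hd⟩
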